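/- Let $G$ be a finite simple graph on $n$ vertices with neighbourhoods $N_j$ and adjacency matrix $\theta$, let $|G\rangle=\prod_{\{i,j\}\in E}(U_{cz})_{ij}|+\rangle^{\otimes n}$ be its graph state ($U_{cz}$ the controlled phase gate), and let $\mathcal S_G$ be its stabilizer, the group generated by the operators $X_j\bigotimes_{k\in N_j}Z_k$. Let $\mathcal P_n$ be the $n$-qubit Pauli group, $\mathcal C_n$ the local Clifford group (generated by the tensor products $c_1\otimes\dots\otimes c_n$ with $c_j\in U(2)$ normalizing the one-qubit Pauli group), and $U_G=\{U=U_1\otimes\dots\otimes U_n\in U(2)^{\otimes n}: U|G\rangle\propto|G\rangle\}$. Two operators are equal up to local Pauli operators if $U=c\,P\,V$ with $P\in\mathcal P_n$ and a scalar $c$. Call $U$ admissible if $U\in U_G\cap\mathcal C_n$, $U^4=\mathbb 1$, and $U$ is not a scalar multiple of an element of $\mathcal S_G$. For an ordering of the vertices and an integer $d$ with $1\le d\le n$, write the adjacency matrix in this ordering as $\theta=\begin{pmatrix}\theta_{00}&\theta_{01}\\ \theta_{10}&\theta_{11}\end{pmatrix}$ with $\theta_{00}$ of size $d\times d$ and $\theta_{11}$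 of size $(n-d)\times(n-d)$, and let $X$ and $Y$ be the diagonal matrices with $X_{ii}=\sum_{j\le d}\theta_{ij}$ $(i\le d)$ and $Y_{ii}=\sum_{j\le d}\theta_{i+d,j}$ $(i\le n-d)$. The pair (ordering, $d$) is a solution if, over $\mathbb Z_2$, $$(\theta_{00}+X)^2=0,\qquad (\theta_{00}+X)\,\theta_{01}=0,\qquad \theta_{01}^T\theta_{01}+Y=0 .$$ (1) There exists an admissible $U$ if and only if there exists a solution. (2) The solutions correspond uniquely to the admissible symmetries up to local Pauli operators. To a solution associate the operator that acts on the $i$-th vertex of the ordering, for $i\le d$, as $e^{i\frac{\pi}{4}X}$ if $X_{ii}=0$ and as $e^{i\frac{\pi}{4}Y}$ if $X_{ii}=1$ (with the Pauli operators in the exponents), and on the $(i+d)$-th vertex as $\mathbb 1$ if $Y_{ii}=0$ and as $e^{i\frac{\pi}{4}Z}$ if $Y_{ii}=1$. For every solution there is an admissible $U$ equal to this operator up to local Pauli operators; every admissible $U$ arises in this way from some solution; and if admissible $U,U'$ arise from two solutions, then $U$ and $U'$ are equal up to local Pauli operators if and only if the two solutions have the same set of first $d$ vertices (in particular the same $d$).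 (3) Let $\sigma_j\in\{X,Y,Z\}$ for $j$ in some set $T$ of qubits. If $P\,\bigl(\bigotimes_{j\in T}e^{i\frac{\pi}{4}\sigma_j}\otimes\mathbb 1\bigr)\in U_G$ for some $P\in\mathcal P_n$, then $(-1)^k\bigl(\bigotimes_{j\in T}\sigma_j\otimes\mathbb 1\bigr)\in\mathcal S_G$ for some $k\in\{0,1\}$. -/

import Mathlib

namespace GraphStateSym

open Matrix

/-! ## Qubit registers and local unitaries -/

/-- Labels of the computational basis of `n` qubits. The space `(ℂ²)^{⊗ n}` is modelled by its
coordinates `(Fin n → Fin 2) → ℂ` in the computational (tensor product) basis. -/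
abbrev Bits (n : ℕ) : Type := Fin n → Fin 2

/-- The unitary group `U(2)` of one qubit. -/
abbrev U2 : Type := unitaryGroup (Fin 2) ℂ

/-- The unitary group of `n` qubits. -/
abbrev Un (n : ℕ) : Type := unitaryGroup (Bits n) ℂ

/-- The matrix of `A₁ ⊗ ⋯ ⊗ Aₙ` in the computational basis. -/
def tensorMatrix {n : ℕ} (A : Fin n → Matrix (Fin 2) (Fin 2) ℂ) : Matrix (Bits n) (Bits n) ℂ :=
  Matrix.of fun x y => ∏ j, A j (x j) (y j)

theorem tensorMatrix_mul {n : ℕ} (A B : Fin n → Matrix (Fin 2) (Fin 2) ℂ) :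
    tensorMatrix A * tensorMatrix B = tensorMatrix fun j => A j * B j := by
  ext x y
  simp only [tensorMatrix, Matrix.mul_apply, Matrix.of_apply]
  rw [Finset.prod_univ_sum]
  simp [Finset.prod_mul_distrib]

theorem tensorMatrix_one {n : ℕ} :
    tensorMatrix (fun _ : Fin n => (1 : Matrix (Fin 2) (Fin 2) ℂ)) = 1 := by
  ext x y
  simp only [tensorMatrix, Matrix.of_apply, Matrix.one_apply]
  rw [Finset.prod_boole]
  simp [funext_iff]

theorem tensorMatrix_star {n : ℕ} (A : Fin n → Matrix (Fin 2) (Fin 2) ℂ) :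
    star (tensorMatrix A) = tensorMatrix fun j => star (A j) := by
  ext x y
  simp [tensorMatrix, Matrix.star_apply]

/-- The tensor product `u₁ ⊗ ⋯ ⊗ uₙ` of single-qubit unitaries, as an `n`-qubit unitary. -/
def tensor {n : ℕ} (u : Fin n → U2) : Un n :=
  ⟨tensorMatrix fun j => (u j : Matrix (Fin 2) (Fin 2) ℂ), by
    rw [mem_unitaryGroup_iff, tensorMatrix_star, tensorMatrix_mul, ← tensorMatrix_one]
    congr 1
    funext j
    exact mem_unitaryGroup_iff.mp (u j).2⟩

/-- Two operators are equal up to a scalar factor (for unitaries: up to a phase). -/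
def Proportional {n : ℕ} (U V : Un n) : Prop :=
  ∃ c : ℂ, (U : Matrix (Bits n) (Bits n) ℂ) = c • (V : Matrix (Bits n) (Bits n) ℂ)

/-! ## Pauli operators and the Clifford group -/

/-- Labels of the identity and the three Pauli operators. -/
inductive PauliLabel : Type
  | I
  | X
  | Y
  | Z

/-- The matrices `1, X, Y, Z`. -/
def PauliLabel.mat : PauliLabel → Matrix (Fin 2) (Fin 2) ℂ
  | .I => 1
  | .X => !![0, 1; 1, 0]
  | .Y => !![0, -Complex.I; Complex.I, 0]
  | .Z => !![1, 0; 0, -1]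

theorem PauliLabel.star_mat (p : PauliLabel) : star p.mat = p.mat := by
  cases p <;> ext i j <;> fin_cases i <;> fin_cases j <;>
    simp [PauliLabel.mat, Matrix.star_apply]

theorem PauliLabel.mat_mul_self (p : PauliLabel) : p.mat * p.mat = 1 := by
  cases p <;> ext i j <;> fin_cases i <;> fin_cases j <;>
    simp [PauliLabel.mat, Matrix.mul_apply, Fin.sum_univ_two]

/-- `1, X, Y, Z` as unitaries. -/
def PauliLabel.op (p : PauliLabel) : U2 :=
  ⟨p.mat, by rw [mem_unitaryGroup_iff, p.star_mat, p.mat_mul_self]⟩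

/-- The unitary `exp (i π / 4 · σ)` for `σ ∈ {1, X, Y, Z}`. -/
noncomputable def PauliLabel.expQuarter (p : PauliLabel) : U2 :=
  ⟨NormedSpace.exp ((Complex.I * (Real.pi / 4 : ℝ)) • p.mat), by
    have h : star ((Complex.I * (Real.pi / 4 : ℝ)) • p.mat)
        = -((Complex.I * (Real.pi / 4 : ℝ)) • p.mat) := by
      rw [star_smul, p.star_mat, ← neg_smul]
      congr 1
      rw [Complex.star_def, map_mul, Complex.conj_I, Complex.conj_ofReal, neg_mul]
    have hc : Commute ((Complex.I * (Real.pi / 4 : ℝ)) • p.mat)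
        (-((Complex.I * (Real.pi / 4 : ℝ)) • p.mat)) := (Commute.refl _).neg_right
    rw [mem_unitaryGroup_iff, star_eq_conjTranspose, ← Matrix.exp_conjTranspose,
      ← star_eq_conjTranspose, h, ← Matrix.exp_add_of_commute _ _ hc, add_neg_cancel,
      NormedSpace.exp_zero]⟩

/-- The tensor factor belonging to a label: `exp (i π / 4 · σ)` for `σ ∈ {X, Y, Z}`, and the
identity on a qubit with label `I`. -/
noncomputable def PauliLabel.factor : PauliLabel → U2
  | .I => 1
  | .X => PauliLabel.X.expQuarter
  | .Y => PauliLabel.Y.expQuarter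
  | .Z => PauliLabel.Z.expQuarter

/-- The one-qubit Pauli group `⟨X, Y, Z⟩`. -/
def pauli1 : Subgroup U2 :=
  Subgroup.closure {PauliLabel.X.op, PauliLabel.Y.op, PauliLabel.Z.op}

/-- The `n`-qubit Pauli group. -/
def pauliGroup (n : ℕ) : Subgroup (Un n) :=
  Subgroup.closure {P | ∃ p : Fin n → U2, (∀ j, p j ∈ pauli1) ∧ P = tensor p}

/-- The one-qubit Clifford group (as a set of unitaries, phases included). -/
def clifford1 : Set U2 :=
  {u | ∀ p ∈ pauli1, u * p * u⁻¹ ∈ pauli1}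

/-- The local Clifford group of `n` qubits. -/
def localClifford (n : ℕ) : Subgroup (Un n) :=
  Subgroup.closure {C | ∃ c : Fin n → U2, (∀ j, c j ∈ clifford1) ∧ C = tensor c}

/-- `⊗ⱼ σⱼ` for a string of Pauli labels. -/
def pauliString {n : ℕ} (σ : Fin n → PauliLabel) : Un n :=
  tensor fun j => (σ j).op

/-- `⊗ exp (i π / 4 · σⱼ) ⊗ 1`, where the identity acts on the qubits with label `I`. -/
noncomputable def expString {n : ℕ} (σ : Fin n → PauliLabel) : Un n :=
  tensor fun j => (σ j).factor

/-- Equality of `n`-qubit unitaries up to local Pauli operators (and a phase). -/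
def PauliEquiv {n : ℕ} (U V : Un n) : Prop :=
  ∃ P ∈ pauliGroup n, Proportional U (P * V)

/-! ## Graph states -/

/-- The state `|+⟩^{⊗ n}`. -/
noncomputable def plusState (n : ℕ) : Bits n → ℂ :=
  fun _ => ∏ _j : Fin n, ((1 / Real.sqrt 2 : ℝ) : ℂ)

/-- The diagonal of the controlled phase gate acting on qubits `i` and `j`. -/
def czDiag {n : ℕ} (i j : Fin n) : Bits n → ℂ :=
  fun x => if x i = 1 ∧ x j = 1 then -1 else 1

/-- The graph state: the controlled phase gates of all edges applied to `|+⟩^{⊗ n}`. (The gates are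
diagonal matrices, so their product is the diagonal matrix of the pointwise product. Every edge is
listed once, by its pair `i < j`.) -/
noncomputable def graphState {n : ℕ} (G : SimpleGraph (Fin n)) [DecidableRel G.Adj] :
    Bits n → ℂ :=
  Matrix.diagonal
    (∏ e : Fin n × Fin n with e.1 < e.2 ∧ G.Adj e.1 e.2, czDiag e.1 e.2) *ᵥ plusState n

/-- The canonical generator `X_j ⊗ ⨂_{k ∈ N_j} Z_k`. -/
def canonicalGenerator {n : ℕ} (G : SimpleGraph (Fin n)) [DecidableRel G.Adj] (j : Fin n) : Un n :=
  pauliString fun k => if k = j then .X else if G.Adj j k then .Z else .I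

/-- The stabilizer of the graph state. -/
def stabilizer {n : ℕ} (G : SimpleGraph (Fin n)) [DecidableRel G.Adj] : Subgroup (Un n) :=
  Subgroup.closure (Set.range (canonicalGenerator G))

/-- The local unitary symmetries `U = U₁ ⊗ ⋯ ⊗ Uₙ` of a state `ψ`, i.e. those with `U ψ ∝ ψ`. -/
def localUnitarySymmetries {n : ℕ} (ψ : Bits n → ℂ) : Set (Un n) :=
  {U | (∃ u : Fin n → U2, U = tensor u) ∧
    ∃ c : ℂ, (U : Matrix (Bits n) (Bits n) ℂ) *ᵥ ψ = c • ψ}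

/-- A local Clifford symmetry `U` of the graph state with `U⁴ = 1` which is not (up to a phase) an
element of the stabilizer. -/
def IsNewLC4Symmetry {n : ℕ} (G : SimpleGraph (Fin n)) [DecidableRel G.Adj] (U : Un n) : Prop :=
  U ∈ localUnitarySymmetries (graphState G) ∧ U ∈ localClifford n ∧
    (∀ S ∈ stabilizer G, ¬ Proportional U S) ∧ U ^ 4 = 1

/-! ## The equations over `ℤ/2` -/

/-- Position `i` of the first block of size `d`. -/
def fstIdx {n d : ℕ} (h : d ≤ n) (i : Fin d) : Fin n := Fin.castLE h i

/-- Position `d + i`, i.e. position `i` of the second block, which has size `n - d`. -/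
def sndIdx {n d : ℕ} (h : d ≤ n) (i : Fin (n - d)) : Fin n :=
  Fin.cast (Nat.add_sub_of_le h) (Fin.natAdd d i)

section Blocks

variable {n : ℕ} (G : SimpleGraph (Fin n)) [DecidableRel G.Adj]

/-- The adjacency matrix over `ℤ/2` with respect to the ordering `π 0, π 1, …` of the vertices. -/
def orderedAdj (π : Equiv.Perm (Fin n)) : Matrix (Fin n) (Fin n) (ZMod 2) :=
  (G.adjMatrix (ZMod 2)).submatrix π π

/-- The upper left block, of size `d × d`. -/
def theta00 (π : Equiv.Perm (Fin n)) {d : ℕ} (h : d ≤ n) : Matrix (Fin d) (Fin d) (ZMod 2) :=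
  (orderedAdj G π).submatrix (fstIdx h) (fstIdx h)

/-- The upper right block, of size `d × (n - d)`. -/
def theta01 (π : Equiv.Perm (Fin n)) {d : ℕ} (h : d ≤ n) :
    Matrix (Fin d) (Fin (n - d)) (ZMod 2) :=
  (orderedAdj G π).submatrix (fstIdx h) (sndIdx h)

/-- The diagonal matrix with entries `∑_{j ≤ d} θ_{i j}`. -/
def matX (π : Equiv.Perm (Fin n)) {d : ℕ} (h : d ≤ n) : Matrix (Fin d) (Fin d) (ZMod 2) :=
  Matrix.diagonal fun i => ∑ j : Fin d, orderedAdj G π (fstIdx h i) (fstIdx h j)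

/-- The diagonal matrix with entries `∑_{j ≤ d} θ_{i + d, j}`. -/
def matY (π : Equiv.Perm (Fin n)) {d : ℕ} (h : d ≤ n) :
    Matrix (Fin (n - d)) (Fin (n - d)) (ZMod 2) :=
  Matrix.diagonal fun i => ∑ j : Fin d, orderedAdj G π (sndIdx h i) (fstIdx h j)

/-- The ordering `π` together with `1 ≤ d ≤ n` solves the three matrix equations. -/
def IsSolution (π : Equiv.Perm (Fin n)) {d : ℕ} (h : d ≤ n) : Prop :=
  1 ≤ d ∧
    (theta00 G π h + matX G π h) ^ 2 = 0 ∧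
    (theta00 G π h + matX G π h) * theta01 G π h = 0 ∧
    (theta01 G π h)ᵀ * theta01 G π h + matY G π h = 0

/-- The set of the first `d` vertices in the ordering `π`. -/
def firstBlock (π : Equiv.Perm (Fin n)) {d : ℕ} (h : d ≤ n) : Finset (Fin n) :=
  Finset.univ.image fun i : Fin d => π (fstIdx h i)

/-- The Pauli labels belonging to a set `D` of vertices. With `C` the indicator of `D` and
`B_j = ∑_{k ∈ D} θ_{j k}`, the label at `j` is `I, X, Z, Y` when `(B_j, C_j)` is
`(0,0), (0,1), (1,0), (1,1)`. For `D` the first `d` vertices of an ordering, the `B_j` are the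
diagonal entries of `matX` and `matY`. -/
def blockLabel (D : Finset (Fin n)) (j : Fin n) : PauliLabel :=
  if j ∈ D then
    if ∑ k ∈ D, G.adjMatrix (ZMod 2) j k = 0 then .X else .Y
  else
    if ∑ k ∈ D, G.adjMatrix (ZMod 2) j k = 0 then .I else .Z

/-- `U` is, up to local Pauli operators, the local Clifford operator `⊗ exp (i π / 4 · σⱼ) ⊗ 1`
that belongs to the ordering `π` and to `d`. -/
def CorrespondsTo (π : Equiv.Perm (Fin n)) {d : ℕ} (h : d ≤ n) (U : Un n) : Prop :=
  PauliEquiv U (expString (blockLabel G (firstBlock π h)))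

end Blocks

end GraphStateSym

/-! Modulo scalars, a Pauli operator is a binary vector (a, b), standing for the tensor product of
the X^(a_j) Z^(b_j), and products become sums. The graph state is encoded by the subspace L of the
vectors (a, θa): `weyl_mulVec_graphState_aligned_iff` says that these are exactly the Paulis
preserving it up to a scalar.

A one-qubit Clifford operator acts on the binary plane through GL₂(𝔽₂) ≅ S₃. If its fourth power is
scalar, this action has order 1 or 2, so it is trivial or a transvection v ↦ v + ω(p, v) p with p ≠
0, which is the action of exp(iπ/4 σ) for the Pauli σ with vector p. Hence an admissible U is a
Pauli times `expString σ` (`exists_pauliEquiv_expString`), and the labels are unique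
(`eq_of_pauliEquiv_expString`).

Let C and B be the vectors of X- and Z-exponents of σ. A symmetry must map L to itself. With the
weights w_j = C_j (θa)_j + B_j a_j, this says wB = θ(wC) for every a, the products wB and wC being
entrywise. Pairing with a and using that θ is symmetric gives ∑ w_j² = 0. Over 𝔽₂ squaring is the
identity, so the linear form ∑ w_j vanishes for every a, which is B = θC
(`zbit_eq_of_twistInvariant`). This is the stabilizer claim (3), and it shows that σ is determined
by the support D of C.

With diagonal matrices C and B and N = θC + B, the weights are Nᵀa, so invariance of L is N Nᵀ = 0
(`twistInvariant_iff`). Listing D first, the blocks of N Nᵀ are the three equations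
(`isSolution_iff`).

Conversely, if L is invariant, `expString σ` sends the graph state to a joint eigenvector of the
canonical generators with eigenvalues ±1. A Pauli Z^s repairs the signs and phases on the single
qubits make the fourth power 1. The empty D corresponds exactly to the Pauli symmetries, which are
the multiples of stabilizer elements. -/

namespace GraphStateSym

open Matrix

/-! ## Alignment: equality up to a nonzero scalar -/

section Aligned

/-- Equality up to a nonzero complex factor. -/
def Aligned {M : Type*} [SMul ℂ M] (a b : M) : Prop :=
  ∃ c : ℂ, c ≠ 0 ∧ a = c • b

variable {M : Type*} [AddCommGroup M] [Module ℂ M]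

theorem Aligned.refl (a : M) : Aligned a a := ⟨1, one_ne_zero, (one_smul _ _).symm⟩

theorem Aligned.of_eq {a b : M} (h : a = b) : Aligned a b := h ▸ Aligned.refl a

theorem Aligned.symm {a b : M} (h : Aligned a b) : Aligned b a := by
  obtain ⟨c, hc, rfl⟩ := h
  exact ⟨c⁻¹, inv_ne_zero hc, (inv_smul_smul₀ hc b).symm⟩

theorem Aligned.trans {a b c : M} (h : Aligned a b) (h' : Aligned b c) : Aligned a c := by
  obtain ⟨x, hx, rfl⟩ := h
  obtain ⟨y, hy, rfl⟩ := h'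
  exact ⟨x * y, mul_ne_zero hx hy, smul_smul _ _ _⟩

theorem aligned_smul {c : ℂ} (hc : c ≠ 0) (a : M) : Aligned (c • a) a := ⟨c, hc, rfl⟩

variable {m : Type*} [Fintype m] [DecidableEq m]

theorem Aligned.mul {A B C D : Matrix m m ℂ} (h : Aligned A B) (h' : Aligned C D) :
    Aligned (A * C) (B * D) := by
  obtain ⟨x, hx, rfl⟩ := h
  obtain ⟨y, hy, rfl⟩ := h'
  exact ⟨x * y, mul_ne_zero hx hy, by rw [smul_mul_smul_comm]⟩

theorem Aligned.mul_left {A B : Matrix m m ℂ} (h : Aligned A B) (C : Matrix m m ℂ) :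
    Aligned (C * A) (C * B) := (Aligned.refl C).mul h

theorem Aligned.mul_right {A B : Matrix m m ℂ} (h : Aligned A B) (C : Matrix m m ℂ) :
    Aligned (A * C) (B * C) := h.mul (Aligned.refl C)

omit [DecidableEq m] in
theorem Aligned.mulVec {A B : Matrix m m ℂ} {v w : m → ℂ} (h : Aligned A B) (h' : Aligned v w) :
    Aligned (A *ᵥ v) (B *ᵥ w) := by
  obtain ⟨x, hx, rfl⟩ := h
  obtain ⟨y, hy, rfl⟩ := h'
  exact ⟨x * y, mul_ne_zero hx hy, by rw [smul_mulVec, mulVec_smul, smul_smul]⟩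

theorem coe_mul_inv (U : unitaryGroup m ℂ) :
    (U : Matrix m m ℂ) * ((U⁻¹ : unitaryGroup m ℂ) : Matrix m m ℂ) = 1 :=
  mem_unitaryGroup_iff.mp U.2

theorem coe_inv_mul (U : unitaryGroup m ℂ) :
    ((U⁻¹ : unitaryGroup m ℂ) : Matrix m m ℂ) * (U : Matrix m m ℂ) = 1 :=
  mem_unitaryGroup_iff'.mp U.2

theorem Aligned.mul_right_cancel {A B : Matrix m m ℂ} (U : unitaryGroup m ℂ)
    (h : Aligned (A * (U : Matrix m m ℂ)) (B * (U : Matrix m m ℂ))) : Aligned A B := by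
  simpa [Matrix.mul_assoc, coe_mul_inv] using
    h.mul_right ((U⁻¹ : unitaryGroup m ℂ) : Matrix m m ℂ)

theorem Aligned.mul_left_cancel {A B : Matrix m m ℂ} (U : unitaryGroup m ℂ)
    (h : Aligned ((U : Matrix m m ℂ) * A) ((U : Matrix m m ℂ) * B)) : Aligned A B := by
  simpa [← Matrix.mul_assoc, coe_inv_mul] using
    h.mul_left ((U⁻¹ : unitaryGroup m ℂ) : Matrix m m ℂ)

theorem Aligned.inv {U : unitaryGroup m ℂ} {A : Matrix m m ℂ}
    (h : Aligned (U : Matrix m m ℂ) A) (hA : Aligned (A * A) 1) :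
    Aligned ((U⁻¹ : unitaryGroup m ℂ) : Matrix m m ℂ) A := by
  refine Aligned.mul_left_cancel U ?_
  rw [coe_mul_inv]
  exact hA.symm.trans (h.symm.mul_right A)

theorem unitary_ne_zero [Nonempty m] (U : unitaryGroup m ℂ) : (U : Matrix m m ℂ) ≠ 0 := by
  intro h
  have := coe_mul_inv U
  rw [h, Matrix.zero_mul] at this
  exact zero_ne_one this

theorem aligned_of_eq_smul [Nonempty m] {U : unitaryGroup m ℂ} {A : Matrix m m ℂ} {c : ℂ}
    (h : (U : Matrix m m ℂ) = c • A) : Aligned (U : Matrix m m ℂ) A := by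
  refine ⟨c, ?_, h⟩
  rintro rfl
  exact unitary_ne_zero U (by rw [h, zero_smul])

theorem proportional_iff_aligned {n : ℕ} {U V : Un n} :
    Proportional U V ↔
      Aligned (U : Matrix (Bits n) (Bits n) ℂ) (V : Matrix (Bits n) (Bits n) ℂ) :=
  ⟨fun ⟨_, h⟩ => aligned_of_eq_smul h, fun ⟨c, _, h⟩ => ⟨c, h⟩⟩

end Aligned

/-! ## Tensor products -/

theorem tensorMatrix_smul {n : ℕ} (c : Fin n → ℂ) (A : Fin n → Matrix (Fin 2) (Fin 2) ℂ) :
    tensorMatrix (fun j => c j • A j) = (∏ j, c j) • tensorMatrix A := by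
  ext x y
  simp [tensorMatrix, Finset.prod_mul_distrib]

theorem Aligned.tensorMatrix {n : ℕ} {A B : Fin n → Matrix (Fin 2) (Fin 2) ℂ}
    (h : ∀ j, Aligned (A j) (B j)) :
    Aligned (tensorMatrix A) (GraphStateSym.tensorMatrix B) := by
  choose c hc h using h
  refine ⟨∏ j, c j, Finset.prod_ne_zero_iff.mpr fun j _ => hc j, ?_⟩
  rw [← tensorMatrix_smul]
  congr 1
  exact funext h

/-- Fixing a nonzero entry of `A k` in every slot other than `j` turns the remaining product into a
scalar, and the entries of slot `j` stay free. -/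
theorem Aligned.of_tensorMatrix {n : ℕ} {A B : Fin n → Matrix (Fin 2) (Fin 2) ℂ}
    (hA : ∀ j, A j ≠ 0) (h : Aligned (GraphStateSym.tensorMatrix A) (GraphStateSym.tensorMatrix B))
    (j : Fin n) : Aligned (A j) (B j) := by
  obtain ⟨c, hc, h⟩ := h
  have hne : ∀ k, ∃ x y, A k x y ≠ 0 := by
    intro k
    by_contra! hk
    exact hA k (by ext x y; simp [hk])
  choose x y hxy using hne
  have key : ∀ a b, A j a b * ∏ k ∈ Finset.univ.erase j, A k (x k) (y k)
      = c * (B j a b * ∏ k ∈ Finset.univ.erase j, B k (x k) (y k)) := by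
    intro a b
    have := congrFun (congrFun h (Function.update x j a)) (Function.update y j b)
    simp only [GraphStateSym.tensorMatrix, Matrix.smul_apply, Matrix.of_apply, smul_eq_mul] at this
    rw [← Finset.mul_prod_erase _ _ (Finset.mem_univ j),
      ← Finset.mul_prod_erase (f := fun k => B k _ _) _ (Finset.mem_univ j)] at this
    simp only [Function.update_self] at this
    convert this using 4 with k hk k hk
    all_goals
      have := Finset.ne_of_mem_erase hk
      simp [this]
  have hP : ∏ k ∈ Finset.univ.erase j, A k (x k) (y k) ≠ 0 :=
    Finset.prod_ne_zero_iff.mpr fun k _ => hxy k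
  set P := ∏ k ∈ Finset.univ.erase j, A k (x k) (y k)
  set Q := ∏ k ∈ Finset.univ.erase j, B k (x k) (y k)
  -- If `Q` vanished, so would the product of the chosen nonzero entries of all the `A k`.
  have hQ : Q ≠ 0 := by
    intro h0
    have := key (x j) (y j)
    rw [h0, mul_zero, mul_zero] at this
    exact mul_ne_zero (hxy j) hP this
  refine ⟨c * Q / P, div_ne_zero (mul_ne_zero hc hQ) hP, ?_⟩
  ext a b
  rw [Matrix.smul_apply, smul_eq_mul]
  field_simp
  linear_combination key a b

theorem tensor_mul {n : ℕ} (u v : Fin n → U2) : tensor u * tensor v = tensor (u * v) :=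
  Subtype.ext (tensorMatrix_mul _ _)

theorem tensor_one {n : ℕ} : tensor (1 : Fin n → U2) = 1 :=
  Subtype.ext tensorMatrix_one

theorem tensor_inv {n : ℕ} (u : Fin n → U2) : (tensor u)⁻¹ = tensor u⁻¹ :=
  inv_eq_of_mul_eq_one_right (by rw [tensor_mul, mul_inv_cancel, tensor_one])

theorem tensor_pow {n : ℕ} (u : Fin n → U2) (k : ℕ) : tensor u ^ k = tensor (u ^ k) := by
  induction k with
  | zero => simp [tensor_one]
  | succ k ih => rw [pow_succ, ih, tensor_mul, pow_succ]

/-! ## Weyl operators of one qubit -/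

/-- The nontrivial character of `ℤ/2`. -/
def sgn (a : ZMod 2) : ℂ := if a = 0 then 1 else -1

@[simp] theorem sgn_zero : sgn 0 = 1 := rfl

@[simp] theorem sgn_one : sgn 1 = -1 := if_neg one_ne_zero

theorem zmod_two_cases (a : ZMod 2) : a = 0 ∨ a = 1 := by
  revert a; decide

theorem sgn_add (a b : ZMod 2) : sgn (a + b) = sgn a * sgn b := by
  rcases zmod_two_cases a with rfl | rfl <;> rcases zmod_two_cases b with rfl | rfl <;>
    simp [CharTwo.add_self_eq_zero]

theorem sgn_ne_zero (a : ZMod 2) : sgn a ≠ 0 := by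
  rcases zmod_two_cases a with rfl | rfl <;> simp

theorem sgn_mul_self (a : ZMod 2) : sgn a * sgn a = 1 := by
  rw [← sgn_add, CharTwo.add_self_eq_zero, sgn_zero]

theorem sgn_eq_one_iff {a : ZMod 2} : sgn a = 1 ↔ a = 0 := by
  rcases zmod_two_cases a with rfl | rfl <;> norm_num

theorem prod_sgn {ι : Type*} (s : Finset ι) (f : ι → ZMod 2) :
    ∏ j ∈ s, sgn (f j) = sgn (∑ j ∈ s, f j) := by
  classical
  induction s using Finset.induction_on with
  | empty => simp
  | insert a s ha ih => rw [Finset.prod_insert ha, Finset.sum_insert ha, sgn_add, ih]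

/-- The operator `X ^ a * Z ^ b` of one qubit. -/
def weyl1 (a b : ZMod 2) : Matrix (Fin 2) (Fin 2) ℂ :=
  -- Basis labels in `Fin 2` are read in `ZMod 2`, which unfolds to the same type, so that X^a is
  -- the shift by `a`.
  Matrix.of fun x y : ZMod 2 => if y = x + a then sgn (b * y) else 0

theorem weyl1_eq (a b : ZMod 2) : weyl1 a b =
    !![if (0 : ZMod 2) = 0 + a then sgn (b * 0) else 0,
      if (1 : ZMod 2) = 0 + a then sgn (b * 1) else 0;
      if (0 : ZMod 2) = 1 + a then sgn (b * 0) else 0,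
      if (1 : ZMod 2) = 1 + a then sgn (b * 1) else 0] := by
  ext i j; fin_cases i <;> fin_cases j <;> rfl

theorem weyl1_zero_zero : weyl1 0 0 = 1 := by
  simp [weyl1_eq, Matrix.one_fin_two]

theorem weyl1_one_zero : weyl1 1 0 = !![0, 1; 1, 0] := by
  simp [weyl1_eq, CharTwo.add_self_eq_zero]

theorem weyl1_zero_one : weyl1 0 1 = !![1, 0; 0, -1] := by
  simp [weyl1_eq]

theorem weyl1_one_one : weyl1 1 1 = !![0, -1; 1, 0] := by
  simp [weyl1_eq, CharTwo.add_self_eq_zero]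

theorem weyl1_mul (a b a' b' : ZMod 2) :
    weyl1 a b * weyl1 a' b' = sgn (b * a') • weyl1 (a + a') (b + b') := by
  rcases zmod_two_cases a with rfl | rfl <;> rcases zmod_two_cases b with rfl | rfl <;>
  rcases zmod_two_cases a' with rfl | rfl <;> rcases zmod_two_cases b' with rfl | rfl <;>
    simp [CharTwo.add_self_eq_zero, weyl1_zero_zero, weyl1_one_zero, weyl1_zero_one,
      weyl1_one_one, Matrix.one_fin_two]

theorem weyl1_mul_self (a b : ZMod 2) : Aligned (weyl1 a b * weyl1 a b) 1 := by
  rw [weyl1_mul, CharTwo.add_self_eq_zero, CharTwo.add_self_eq_zero, weyl1_zero_zero]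
  exact aligned_smul (sgn_ne_zero _) _

theorem weyl1_mul_comm (a b a' b' : ZMod 2) :
    weyl1 a b * weyl1 a' b' = sgn (b * a' + b' * a) • (weyl1 a' b' * weyl1 a b) := by
  rw [weyl1_mul, weyl1_mul, smul_smul, sgn_add, mul_assoc, sgn_mul_self, mul_one,
    add_comm a, add_comm b]

theorem weyl1_aligned_comm (a b a' b' : ZMod 2) :
    Aligned (weyl1 a b * weyl1 a' b') (weyl1 a' b' * weyl1 a b) :=
  ⟨_, sgn_ne_zero _, weyl1_mul_comm a b a' b'⟩

theorem weyl1_mul_aligned (a b a' b' : ZMod 2) :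
    Aligned (weyl1 a b * weyl1 a' b') (weyl1 (a + a') (b + b')) :=
  ⟨_, sgn_ne_zero _, weyl1_mul a b a' b'⟩

theorem eq_zero_of_weyl1_aligned_one {a b : ZMod 2} (h : Aligned (weyl1 a b) 1) :
    a = 0 ∧ b = 0 := by
  obtain ⟨c, hc, h⟩ := h
  have h00 := congrFun (congrFun h 0) 0
  have h01 := congrFun (congrFun h 0) 1
  have h11 := congrFun (congrFun h 1) 1
  rcases zmod_two_cases a with rfl | rfl <;> rcases zmod_two_cases b with rfl | rfl <;>
    simp [weyl1_zero_zero, weyl1_one_zero, weyl1_zero_one, weyl1_one_one] at h00 h01 h11 ⊢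
  rw [← h00] at h11
  norm_num at h11

theorem eq_of_weyl1_aligned {a b a' b' : ZMod 2} (h : Aligned (weyl1 a b) (weyl1 a' b')) :
    a = a' ∧ b = b' := by
  have h1 : Aligned (weyl1 (a + a') (b + b')) 1 :=
    (weyl1_mul_aligned a b a' b').symm.trans
      ((h.mul_right _).trans (weyl1_mul_self a' b'))
  obtain ⟨h2, h3⟩ := eq_zero_of_weyl1_aligned_one h1
  exact ⟨CharTwo.add_eq_zero.mp h2, CharTwo.add_eq_zero.mp h3⟩

/-! ## Pauli labels as binary vectors -/

/-- The exponent of `X` in a Pauli operator. -/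
def PauliLabel.xbit : PauliLabel → ZMod 2
  | .I => 0
  | .X => 1
  | .Y => 1
  | .Z => 0

/-- The exponent of `Z` in a Pauli operator. -/
def PauliLabel.zbit : PauliLabel → ZMod 2
  | .I => 0
  | .X => 0
  | .Y => 1
  | .Z => 1

theorem PauliLabel.ext_bits {p q : PauliLabel} (hx : p.xbit = q.xbit) (hz : p.zbit = q.zbit) :
    p = q := by
  cases p <;> cases q <;> first | rfl | (exact absurd hx (by decide)) |
    exact absurd hz (by decide)

theorem PauliLabel.exists_bits (a b : ZMod 2) : ∃ p : PauliLabel, p.xbit = a ∧ p.zbit = b := by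
  rcases zmod_two_cases a with rfl | rfl <;> rcases zmod_two_cases b with rfl | rfl
  exacts [⟨.I, rfl, rfl⟩, ⟨.Z, rfl, rfl⟩, ⟨.X, rfl, rfl⟩, ⟨.Y, rfl, rfl⟩]

theorem PauliLabel.mat_aligned (p : PauliLabel) : Aligned p.mat (weyl1 p.xbit p.zbit) := by
  cases p
  · exact .of_eq weyl1_zero_zero.symm
  · exact .of_eq weyl1_one_zero.symm
  · refine ⟨Complex.I, Complex.I_ne_zero, ?_⟩
    simp [PauliLabel.mat, PauliLabel.xbit, PauliLabel.zbit, weyl1_one_one]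
  · exact .of_eq weyl1_zero_one.symm

theorem PauliLabel.op_mem_pauli1 (p : PauliLabel) : p.op ∈ pauli1 := by
  cases p
  · have : PauliLabel.I.op = 1 := rfl
    rw [this]
    exact one_mem _
  all_goals exact Subgroup.subset_closure (by simp)

theorem exists_weyl1_of_mem_pauli1 {u : U2} (h : u ∈ pauli1) :
    ∃ a b, Aligned (u : Matrix (Fin 2) (Fin 2) ℂ) (weyl1 a b) := by
  induction h using Subgroup.closure_induction with
  | mem u hu =>
    simp only [Set.mem_insert_iff, Set.mem_singleton_iff] at hu
    rcases hu with rfl | rfl | rfl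
    exacts [⟨_, _, PauliLabel.mat_aligned .X⟩, ⟨_, _, PauliLabel.mat_aligned .Y⟩,
      ⟨_, _, PauliLabel.mat_aligned .Z⟩]
  | one => exact ⟨0, 0, .of_eq weyl1_zero_zero.symm⟩
  | mul u v _ _ hu hv =>
    obtain ⟨a, b, hu⟩ := hu
    obtain ⟨a', b', hv⟩ := hv
    exact ⟨_, _, (hu.mul hv).trans (weyl1_mul_aligned _ _ _ _)⟩
  | inv u _ hu =>
    obtain ⟨a, b, hu⟩ := hu
    exact ⟨a, b, hu.inv (weyl1_mul_self a b)⟩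

/-! ## The factors `exp (i π / 4 · σ)` -/

/-- The operator `1 + i σ` for `σ ∈ {X, Y, Z}`, and `1` for the label `I`. -/
noncomputable def PauliLabel.factorMat : PauliLabel → Matrix (Fin 2) (Fin 2) ℂ
  | .I => 1
  | .X => !![1, Complex.I; Complex.I, 1]
  | .Y => !![1, 1; -1, 1]
  | .Z => !![1 + Complex.I, 0; 0, 1 - Complex.I]

theorem exp_I_pi_div_four :
    Complex.exp (Complex.I * (Real.pi / 4 : ℝ)) = (Real.sqrt 2 / 2 : ℝ) * (1 + Complex.I) := by
  rw [mul_comm, Complex.exp_mul_I, ← Complex.ofReal_cos, ← Complex.ofReal_sin,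
    Real.cos_pi_div_four, Real.sin_pi_div_four]
  ring

theorem exp_neg_I_pi_div_four :
    Complex.exp (-(Complex.I * (Real.pi / 4 : ℝ))) =
      (Real.sqrt 2 / 2 : ℝ) * (1 - Complex.I) := by
  rw [← mul_neg, mul_comm, ← Complex.ofReal_neg, Complex.exp_mul_I, ← Complex.ofReal_cos,
    ← Complex.ofReal_sin, Real.cos_neg, Real.sin_neg,
    Real.cos_pi_div_four, Real.sin_pi_div_four]
  push_cast
  ring

theorem exp_smul_pauliZ :
    NormedSpace.exp ((Complex.I * (Real.pi / 4 : ℝ)) • PauliLabel.Z.mat) =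
      ((Real.sqrt 2 / 2 : ℝ) : ℂ) • PauliLabel.Z.factorMat := by
  have h : (Complex.I * (Real.pi / 4 : ℝ)) • PauliLabel.Z.mat =
      diagonal ![Complex.I * (Real.pi / 4 : ℝ), -(Complex.I * (Real.pi / 4 : ℝ))] := by
    ext i j; fin_cases i <;> fin_cases j <;> simp [PauliLabel.mat]
  rw [h, Matrix.exp_diagonal]
  ext i j
  fin_cases i <;> fin_cases j <;> simp [-Complex.ofReal_div, PauliLabel.factorMat]
  · rw [← Complex.exp_eq_exp_ℂ, exp_I_pi_div_four]
  · rw [← Complex.exp_eq_exp_ℂ, exp_neg_I_pi_div_four]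

/-- The exponential commutes with conjugation, so the diagonal case Z carries over to X and Y, with
`V` a matrix of eigenvectors. -/
theorem exp_smul_of_conj {p : PauliLabel} (V : (Matrix (Fin 2) (Fin 2) ℂ)ˣ)
    (h : p.mat = V * PauliLabel.Z.mat * (V⁻¹ : (Matrix (Fin 2) (Fin 2) ℂ)ˣ))
    (h' : p.factorMat = V * PauliLabel.Z.factorMat * (V⁻¹ : (Matrix (Fin 2) (Fin 2) ℂ)ˣ)) :
    NormedSpace.exp ((Complex.I * (Real.pi / 4 : ℝ)) • p.mat) =
      ((Real.sqrt 2 / 2 : ℝ) : ℂ) • p.factorMat := by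
  rw [h', ← smul_mul_assoc, ← mul_smul_comm, ← exp_smul_pauliZ, ← Matrix.exp_units_conj, h,
    mul_smul_comm, smul_mul_assoc]

theorem exp_smul_pauliX :
    NormedSpace.exp ((Complex.I * (Real.pi / 4 : ℝ)) • PauliLabel.X.mat) =
      ((Real.sqrt 2 / 2 : ℝ) : ℂ) • PauliLabel.X.factorMat := by
  refine exp_smul_of_conj ⟨!![1, 1; 1, -1], !![1 / 2, 1 / 2; 1 / 2, -1 / 2], ?_, ?_⟩ ?_ ?_
  · ext i j; fin_cases i <;> fin_cases j <;> norm_num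
  · ext i j; fin_cases i <;> fin_cases j <;> norm_num
  · ext i j; fin_cases i <;> fin_cases j <;> norm_num [PauliLabel.mat]
  · ext i j; fin_cases i <;> fin_cases j <;> simp [PauliLabel.factorMat] <;> ring

theorem exp_smul_pauliY :
    NormedSpace.exp ((Complex.I * (Real.pi / 4 : ℝ)) • PauliLabel.Y.mat) =
      ((Real.sqrt 2 / 2 : ℝ) : ℂ) • PauliLabel.Y.factorMat := by
  refine exp_smul_of_conj ⟨!![1, 1; Complex.I, -Complex.I],
    !![1 / 2, -Complex.I / 2; 1 / 2, Complex.I / 2], ?_, ?_⟩ ?_ ?_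
  all_goals
    ext i j
    fin_cases i <;> fin_cases j <;> simp [PauliLabel.factorMat, PauliLabel.mat] <;>
      ring_nf <;> simp <;> norm_num

theorem PauliLabel.factor_aligned (p : PauliLabel) :
    Aligned (p.factor : Matrix (Fin 2) (Fin 2) ℂ) p.factorMat := by
  have h2 : ((Real.sqrt 2 / 2 : ℝ) : ℂ) ≠ 0 := by
    rw [Complex.ofReal_ne_zero]; positivity
  cases p
  · exact .refl _
  · exact ⟨_, h2, exp_smul_pauliX⟩
  · exact ⟨_, h2, exp_smul_pauliY⟩
  · exact ⟨_, h2, exp_smul_pauliZ⟩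

/-- The symplectic form of a Pauli label with a binary vector. -/
def PauliLabel.pair (p : PauliLabel) (x z : ZMod 2) : ZMod 2 := p.xbit * z + p.zbit * x

/-- A Pauli τ commuting with σ passes through 1 + iσ unchanged. If τ anticommutes with σ, then (1 +
iσ)τ = τ(1 - iσ) = -i τσ (1 + iσ), so the vector of σ is added. This is the transvection along `p`.
-/
theorem PauliLabel.factorMat_mul_weyl1 (p : PauliLabel) (x z : ZMod 2) :
    Aligned (p.factorMat * weyl1 x z)
      (weyl1 (x + p.pair x z * p.xbit) (z + p.pair x z * p.zbit) * p.factorMat) := by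
  have key : ∃ c ∈ ({1, -1, Complex.I, -Complex.I} : Set ℂ), p.factorMat * weyl1 x z =
      c • (weyl1 (x + p.pair x z * p.xbit) (z + p.pair x z * p.zbit) * p.factorMat) := by
    rcases zmod_two_cases x with rfl | rfl <;> rcases zmod_two_cases z with rfl | rfl <;>
      cases p <;> simp [PauliLabel.pair, PauliLabel.xbit, PauliLabel.zbit, PauliLabel.factorMat,
        CharTwo.add_self_eq_zero, weyl1_zero_zero, weyl1_one_zero, weyl1_zero_one,
        weyl1_one_one, Matrix.one_fin_two]
    all_goals
      refine Or.inr (Or.inr (Or.inr ⟨?_, ?_⟩)) <;> ring_nf <;> simp <;> ring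
  obtain ⟨c, hc, h⟩ := key
  refine ⟨c, ?_, h⟩
  rintro rfl
  simp only [Set.mem_insert_iff, Set.mem_singleton_iff, zero_ne_one, zero_eq_neg, one_ne_zero,
    Complex.I_ne_zero, Complex.I_ne_zero.symm, or_self] at hc

theorem PauliLabel.factor_mul_weyl1 (p : PauliLabel) (x z : ZMod 2) :
    Aligned ((p.factor : Matrix (Fin 2) (Fin 2) ℂ) * weyl1 x z)
      (weyl1 (x + p.pair x z * p.xbit) (z + p.pair x z * p.zbit) *
        (p.factor : Matrix (Fin 2) (Fin 2) ℂ)) :=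
  (p.factor_aligned.mul_right _).trans ((p.factorMat_mul_weyl1 x z).trans
    (p.factor_aligned.symm.mul_left _))

/-- A transvection is an involution here: the form is alternating and the vector of `p` added twice
is zero. -/
theorem PauliLabel.twist_involutive (p : PauliLabel) (x z : ZMod 2) :
    x + p.pair x z * p.xbit + p.pair (x + p.pair x z * p.xbit) (z + p.pair x z * p.zbit) * p.xbit
        = x ∧
      z + p.pair x z * p.zbit + p.pair (x + p.pair x z * p.xbit) (z + p.pair x z * p.zbit) * p.zbit
        = z := by
  unfold PauliLabel.pair
  generalize p.xbit = a
  generalize p.zbit = b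
  revert x z a b
  decide

/-- Conjugation by a Pauli only changes scalars, so both factors induce the same transvection. Its
values at (1, 0) and (0, 1) determine the label. -/
theorem eq_of_factor_aligned {p q : PauliLabel} {a b : ZMod 2}
    (h : Aligned (p.factor : Matrix (Fin 2) (Fin 2) ℂ)
      (weyl1 a b * (q.factor : Matrix (Fin 2) (Fin 2) ℂ))) : p = q := by
  have key : ∀ x z, x + p.pair x z * p.xbit = x + q.pair x z * q.xbit ∧
      z + p.pair x z * p.zbit = z + q.pair x z * q.zbit := by
    intro x z
    refine eq_of_weyl1_aligned (Aligned.mul_right_cancel p.factor ?_)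
    refine (p.factor_mul_weyl1 x z).symm.trans ((h.mul_right _).trans ?_)
    rw [Matrix.mul_assoc]
    refine ((q.factor_mul_weyl1 x z).mul_left _).trans ?_
    rw [← Matrix.mul_assoc]
    refine ((weyl1_aligned_comm _ _ _ _).mul_right _).trans ?_
    rw [Matrix.mul_assoc]
    exact h.symm.mul_left _
  have h10 := key 1 0
  have h01 := key 0 1
  unfold PauliLabel.pair at h10 h01
  apply PauliLabel.ext_bits
  · revert h10 h01
    generalize p.xbit = a, p.zbit = b, q.xbit = c, q.zbit = d
    revert a b c d
    decide
  · revert h10 h01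
    generalize p.xbit = a, p.zbit = b, q.xbit = c, q.zbit = d
    revert a b c d
    decide

/-! ## One-qubit Clifford operators -/

/-- The scalar for Z decides whether `A` is diagonal or antidiagonal. The scalar for X is then
forced to be ±1 and gives the ratio of the two remaining entries. -/
theorem aligned_weyl1_of_commute {A : Matrix (Fin 2) (Fin 2) ℂ} (hA : A ≠ 0)
    (hX : Aligned (A * weyl1 1 0) (weyl1 1 0 * A)) (hZ : Aligned (A * weyl1 0 1) (weyl1 0 1 * A)) :
    ∃ a b, Aligned A (weyl1 a b) := by
  obtain ⟨k, hk, hX⟩ := hX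
  obtain ⟨l, hl, hZ⟩ := hZ
  obtain ⟨p, q, r, s, rfl⟩ : ∃ p q r s, A = !![p, q; r, s] :=
    ⟨_, _, _, _, Matrix.eta_fin_two A⟩
  have x00 := congrFun (congrFun hX 0) 0
  have x01 := congrFun (congrFun hX 0) 1
  have x10 := congrFun (congrFun hX 1) 0
  have x11 := congrFun (congrFun hX 1) 1
  have z00 := congrFun (congrFun hZ 0) 0
  have z01 := congrFun (congrFun hZ 0) 1
  have z10 := congrFun (congrFun hZ 1) 0
  have z11 := congrFun (congrFun hZ 1) 1
  simp [weyl1_one_zero, weyl1_zero_one] at x00 x01 x10 x11 z00 z01 z10 z11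
  by_cases hl1 : l = 1
  · subst hl1
    have hq : q = 0 := by linear_combination -(1 / 2 : ℂ) * z01
    have hr : r = 0 := by linear_combination (1 / 2 : ℂ) * z10
    subst hq hr
    have hp : p ≠ 0 := by
      rintro rfl
      apply hA
      simp at x10
      ext i j
      fin_cases i <;> fin_cases j <;> simp [x10]
    have hk2 : (k - 1) * (k + 1) = 0 := by
      apply mul_left_cancel₀ hp
      linear_combination -x01 - k * x10
    rcases mul_eq_zero.mp hk2 with h | h
    · refine ⟨0, 0, p, hp, ?_⟩
      have : s = p := by linear_combination x10 + p * h
      simp [weyl1_zero_zero, Matrix.one_fin_two, this]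
    · refine ⟨0, 1, p, hp, ?_⟩
      have : s = -p := by linear_combination x10 + p * h
      simp [weyl1_zero_one, this]
  · have hp : p = 0 := by
      by_contra hp
      exact hl1 (mul_right_cancel₀ hp (by linear_combination -z00))
    have hs : s = 0 := by
      by_contra hs
      exact hl1 (mul_right_cancel₀ hs (by linear_combination -z11))
    subst hp hs
    have hr : r ≠ 0 := by
      rintro rfl
      apply hA
      simp at x00
      ext i j
      fin_cases i <;> fin_cases j <;> simp [x00]
    have hk2 : (k - 1) * (k + 1) = 0 := by
      apply mul_left_cancel₀ hr
      linear_combination -x11 - k * x00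
    rcases mul_eq_zero.mp hk2 with h | h
    · refine ⟨1, 0, r, hr, ?_⟩
      have : q = r := by linear_combination x00 + r * h
      simp [weyl1_one_zero, this]
    · refine ⟨1, 1, r, hr, ?_⟩
      have : q = -r := by linear_combination x00 + r * h
      simp [weyl1_one_one, this]

/-- The image of a binary vector under the linear map given by the images of `X` and `Z`. -/
def linImage (m m' : ZMod 2 × ZMod 2) (v : ZMod 2 × ZMod 2) : ZMod 2 × ZMod 2 :=
  (v.1 * m.1 + v.2 * m'.1, v.1 * m.2 + v.2 * m'.2)

-- In GL₂(𝔽₂) ≅ S₃ a fourth power is trivial only for the identity and the three involutions, which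
-- are the transvections. The right-hand sides are the transvection along (a, b) at (1, 0) and (0,
-- 1), with (a, b) = 0 for the identity.
set_option synthInstance.maxSize 1000 in
set_option synthInstance.maxHeartbeats 200000 in
theorem exists_twist_of_linImage_pow_four : ∀ m m' : ZMod 2 × ZMod 2,
    (∀ v, linImage m m' v = 0 → v = 0) →
    (∀ v, linImage m m' (linImage m m' (linImage m m' (linImage m m' v))) = v) →
    ∃ a b : ZMod 2, m = (1 + (a * 0 + b * 1) * a, 0 + (a * 0 + b * 1) * b) ∧
      m' = (0 + (a * 1 + b * 0) * a, 1 + (a * 1 + b * 0) * b) := by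
  decide

theorem clifford1_mul_weyl1 {u : U2} {m m' : ZMod 2 × ZMod 2}
    (hX : Aligned ((u : Matrix (Fin 2) (Fin 2) ℂ) * weyl1 1 0)
      (weyl1 m.1 m.2 * (u : Matrix (Fin 2) (Fin 2) ℂ)))
    (hZ : Aligned ((u : Matrix (Fin 2) (Fin 2) ℂ) * weyl1 0 1)
      (weyl1 m'.1 m'.2 * (u : Matrix (Fin 2) (Fin 2) ℂ))) (v : ZMod 2 × ZMod 2) :
    Aligned ((u : Matrix (Fin 2) (Fin 2) ℂ) * weyl1 v.1 v.2)
      (weyl1 (linImage m m' v).1 (linImage m m' v).2 * (u : Matrix (Fin 2) (Fin 2) ℂ)) := by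
  obtain ⟨x, z⟩ := v
  rcases zmod_two_cases x with rfl | rfl <;> rcases zmod_two_cases z with rfl | rfl
  · simp [linImage, weyl1_zero_zero, Aligned.refl]
  · simpa [linImage] using hZ
  · simpa [linImage] using hX
  · simp only [linImage, one_mul]
    have h := weyl1_mul_aligned 1 0 0 1
    simp only [add_zero, zero_add] at h
    refine (h.symm.mul_left _).trans ?_
    rw [← Matrix.mul_assoc]
    refine (hX.mul_right _).trans ?_
    rw [Matrix.mul_assoc]
    refine (hZ.mul_left _).trans ?_
    rw [← Matrix.mul_assoc]
    exact (weyl1_mul_aligned _ _ _ _).mul_right _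

theorem exists_image_of_mem_clifford1 {u : U2} (hu : u ∈ clifford1) (p : PauliLabel) :
    ∃ m : ZMod 2 × ZMod 2, Aligned ((u : Matrix (Fin 2) (Fin 2) ℂ) * weyl1 p.xbit p.zbit)
      (weyl1 m.1 m.2 * (u : Matrix (Fin 2) (Fin 2) ℂ)) := by
  obtain ⟨a, b, h⟩ := exists_weyl1_of_mem_pauli1 (hu p.op p.op_mem_pauli1)
  refine ⟨(a, b), ?_⟩
  refine (p.mat_aligned.symm.mul_left _).trans ?_
  have h2 := h.mul_right (u : Matrix (Fin 2) (Fin 2) ℂ)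
  have h3 : ((u * p.op * u⁻¹ : U2) : Matrix (Fin 2) (Fin 2) ℂ) *
      (u : Matrix (Fin 2) (Fin 2) ℂ) = (u : Matrix (Fin 2) (Fin 2) ℂ) * p.mat := by
    change ((u * p.op * u⁻¹ * u : U2) : Matrix (Fin 2) (Fin 2) ℂ) = _
    rw [inv_mul_cancel_right]
    rfl
  rwa [h3] at h2

theorem eq_zero_of_linImage_eq_zero {u : U2} {m m' : ZMod 2 × ZMod 2}
    (hM : ∀ v : ZMod 2 × ZMod 2, Aligned ((u : Matrix (Fin 2) (Fin 2) ℂ) * weyl1 v.1 v.2)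
      (weyl1 (linImage m m' v).1 (linImage m m' v).2 * (u : Matrix (Fin 2) (Fin 2) ℂ)))
    (v : ZMod 2 × ZMod 2) (hv : linImage m m' v = 0) : v = 0 := by
  have h := hM v
  rw [hv] at h
  simp only [Prod.fst_zero, Prod.snd_zero, weyl1_zero_zero, Matrix.one_mul] at h
  have h' : Aligned (weyl1 v.1 v.2) 1 :=
    Aligned.mul_left_cancel u (by rwa [Matrix.mul_one])
  exact Prod.ext_iff.mpr (eq_zero_of_weyl1_aligned_one h')

/-- Some factor acts on binary vectors in the same way as `u`. Dividing it out leaves an operator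
that commutes with every Pauli up to a scalar, and such an operator is itself a Pauli up to a
scalar. -/
theorem exists_factor_of_clifford1_pow_four {u : U2} (hu : u ∈ clifford1)
    (h4 : Aligned ((u ^ 4 : U2) : Matrix (Fin 2) (Fin 2) ℂ) 1) :
    ∃ (p : PauliLabel) (a b : ZMod 2), Aligned (u : Matrix (Fin 2) (Fin 2) ℂ)
      (weyl1 a b * (p.factor : Matrix (Fin 2) (Fin 2) ℂ)) := by
  obtain ⟨m, hX⟩ := exists_image_of_mem_clifford1 hu .X
  obtain ⟨m', hZ⟩ := exists_image_of_mem_clifford1 hu .Z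
  have hM := clifford1_mul_weyl1 hX hZ
  have h_inj := eq_zero_of_linImage_eq_zero hM
  have h_four : ∀ v, linImage m m' (linImage m m' (linImage m m' (linImage m m' v))) = v := by
    intro v
    set L := linImage m m' with hL
    set A := (u : Matrix (Fin 2) (Fin 2) ℂ) with hA
    have h : Aligned (A * (A * (A * (A * weyl1 v.1 v.2))))
        (weyl1 (L (L (L (L v)))).1 (L (L (L (L v)))).2 * (A * (A * (A * A)))) := by
      refine ((((hM v).mul_left _).mul_left _).mul_left _).trans ?_
      rw [← Matrix.mul_assoc A (weyl1 _ _)]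
      refine ((((hM _).mul_right _).mul_left _).mul_left _).trans ?_
      rw [Matrix.mul_assoc, ← Matrix.mul_assoc A (weyl1 _ _)]
      refine (((hM _).mul_right _).mul_left _).trans ?_
      rw [Matrix.mul_assoc, ← Matrix.mul_assoc A (weyl1 _ _)]
      refine ((hM _).mul_right _).trans ?_
      rw [Matrix.mul_assoc]
      exact .refl _
    have hA4 : Aligned (A * (A * (A * A))) 1 := by
      have : ((u ^ 4 : U2) : Matrix (Fin 2) (Fin 2) ℂ) = A * (A * (A * A)) := by
        rw [SubmonoidClass.coe_pow]
        simp only [pow_succ, pow_zero, one_mul, Matrix.mul_assoc, A]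
      rwa [this] at h4
    have h' : Aligned (weyl1 v.1 v.2) (weyl1 (L (L (L (L v)))).1 (L (L (L (L v)))).2) := by
      have h1 := h.trans (hA4.mul_left _)
      rw [Matrix.mul_one] at h1
      refine Aligned.trans ?_ h1
      have h2 := hA4.symm.mul_right (weyl1 v.1 v.2)
      simpa only [Matrix.one_mul, Matrix.mul_assoc] using h2
    exact (Prod.ext_iff.mpr (eq_of_weyl1_aligned h')).symm
  obtain ⟨a, b, hm, hm'⟩ := exists_twist_of_linImage_pow_four m m' h_inj h_four
  obtain ⟨p, rfl, rfl⟩ := PauliLabel.exists_bits a b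
  have twist : ∀ x z : ZMod 2, Aligned ((u : Matrix (Fin 2) (Fin 2) ℂ) * weyl1 x z)
      (weyl1 (x + p.pair x z * p.xbit) (z + p.pair x z * p.zbit) *
        (u : Matrix (Fin 2) (Fin 2) ℂ)) := by
    intro x z
    convert hM (x, z) using 3
    · rw [hm, hm']
      simp only [linImage, PauliLabel.pair]
      ring
    · rw [hm, hm']
      simp only [linImage, PauliLabel.pair]
      ring
  set F := (p.factor : Matrix (Fin 2) (Fin 2) ℂ) with hF
  set A := ((u * p.factor⁻¹ : U2) : Matrix (Fin 2) (Fin 2) ℂ) with hA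
  have hAF : A * F = u := by
    change ((u * p.factor⁻¹ * p.factor : U2) : Matrix (Fin 2) (Fin 2) ℂ) = _
    rw [inv_mul_cancel_right]
  have hcomm : ∀ x z : ZMod 2, Aligned (A * weyl1 x z) (weyl1 x z * A) := by
    intro x z
    obtain ⟨e1, e2⟩ := p.twist_involutive x z
    refine Aligned.mul_right_cancel p.factor ?_
    rw [Matrix.mul_assoc, Matrix.mul_assoc, hAF]
    -- Both actions are evaluated at the twisted vector, which the involution sends back to `(x,
    -- z)`.
    have h1 := p.factor_mul_weyl1 (x + p.pair x z * p.xbit) (z + p.pair x z * p.zbit)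
    have h2 := twist (x + p.pair x z * p.xbit) (z + p.pair x z * p.zbit)
    rw [e1, e2] at h1 h2
    refine (h1.symm.mul_left _).trans ?_
    rw [← Matrix.mul_assoc, hAF]
    exact h2
  obtain ⟨a, b, h⟩ := aligned_weyl1_of_commute (unitary_ne_zero _) (hcomm 1 0) (hcomm 0 1)
  exact ⟨p, a, b, by rw [← hAF]; exact h.mul_right _⟩

/-! ### Pauli and Clifford membership from relations up to a scalar. -/

theorem neg_one_mem_pauli1 : (-1 : U2) ∈ pauli1 := by
  have h : (-1 : U2) = (PauliLabel.X.op * PauliLabel.Z.op) * (PauliLabel.X.op * PauliLabel.Z.op) := by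
    apply Subtype.ext
    change -1 = (PauliLabel.X.mat * PauliLabel.Z.mat) * (PauliLabel.X.mat * PauliLabel.Z.mat)
    simp [PauliLabel.mat, Matrix.one_fin_two]
  rw [h]
  have hXZ := mul_mem PauliLabel.X.op_mem_pauli1 PauliLabel.Z.op_mem_pauli1
  exact mul_mem hXZ hXZ

/-- Alignment leaves an arbitrary phase, which need not lie in the Pauli group. Squaring to one, as
every conjugate of X, Y or Z does, restricts the phase to ±1. -/
theorem mem_pauli1_of_aligned {u : U2} {a b : ZMod 2}
    (h : Aligned (u : Matrix (Fin 2) (Fin 2) ℂ) (weyl1 a b)) (h2 : u * u = 1) : u ∈ pauli1 := by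
  obtain ⟨p, rfl, rfl⟩ := PauliLabel.exists_bits a b
  obtain ⟨c, hc, h⟩ := h.trans p.mat_aligned.symm
  have h3 : (u : Matrix (Fin 2) (Fin 2) ℂ) * (u : Matrix (Fin 2) (Fin 2) ℂ) = 1 :=
    congrArg Subtype.val h2
  rw [h, smul_mul_smul_comm, p.mat_mul_self] at h3
  have h4 : c * c = 1 := by simpa using congrFun (congrFun h3 0) 0
  rcases mul_self_eq_one_iff.mp h4 with rfl | rfl
  · have : u = p.op := Subtype.ext (by rw [h, one_smul]; rfl)
    exact this ▸ p.op_mem_pauli1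
  · have : u = -1 * p.op := Subtype.ext (by
      rw [h]
      change _ = (-1 : Matrix (Fin 2) (Fin 2) ℂ) * p.mat
      simp)
    exact this ▸ mul_mem neg_one_mem_pauli1 p.op_mem_pauli1

theorem mem_clifford1_of_aligned {u : U2}
    (h : ∀ x z, ∃ x' z', Aligned ((u : Matrix (Fin 2) (Fin 2) ℂ) * weyl1 x z)
      (weyl1 x' z' * (u : Matrix (Fin 2) (Fin 2) ℂ))) : u ∈ clifford1 := by
  have key : ∀ p : PauliLabel, u * p.op * u⁻¹ ∈ pauli1 := by
    intro p
    obtain ⟨x', z', h⟩ := h p.xbit p.zbit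
    refine mem_pauli1_of_aligned (a := x') (b := z') ?_ ?_
    · refine Aligned.mul_right_cancel u ?_
      change Aligned ((u * p.op * u⁻¹ * u : U2) : Matrix (Fin 2) (Fin 2) ℂ) _
      rw [inv_mul_cancel_right]
      exact (p.mat_aligned.mul_left _).trans h
    · have hp : p.op * p.op = 1 := Subtype.ext p.mat_mul_self
      calc u * p.op * u⁻¹ * (u * p.op * u⁻¹) = u * (p.op * p.op) * u⁻¹ := by group
        _ = 1 := by rw [hp]; group
  intro p hp
  have hle : pauli1 ≤ pauli1.comap (MulAut.conj u).toMonoidHom := by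
    refine (Subgroup.closure_le _).mpr ?_
    rintro q (rfl | rfl | rfl)
    exacts [key .X, key .Y, key .Z]
  exact hle hp

set_option synthInstance.maxHeartbeats 200000 in
theorem linImage_surjective : ∀ m m' : ZMod 2 × ZMod 2,
    (∀ v, linImage m m' v = 0 → v = 0) → ∀ v, ∃ w, linImage m m' w = v := by
  decide

/-- `clifford1` only asks that conjugation map the Pauli group into itself. The induced map on
binary vectors is injective on a finite set, hence onto, so it can be inverted. -/
theorem inv_mem_clifford1 {u : U2} (hu : u ∈ clifford1) : u⁻¹ ∈ clifford1 := by
  obtain ⟨m, hX⟩ := exists_image_of_mem_clifford1 hu .X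
  obtain ⟨m', hZ⟩ := exists_image_of_mem_clifford1 hu .Z
  have hM := clifford1_mul_weyl1 hX hZ
  refine mem_clifford1_of_aligned fun x z => ?_
  obtain ⟨w, hw⟩ := linImage_surjective m m' (eq_zero_of_linImage_eq_zero hM) (x, z)
  refine ⟨w.1, w.2, Aligned.mul_left_cancel u (Aligned.mul_right_cancel u ?_)⟩
  have h := hM w
  rw [hw] at h
  have e1 : (u : Matrix (Fin 2) (Fin 2) ℂ) * (((u⁻¹ : U2) : Matrix (Fin 2) (Fin 2) ℂ) * weyl1 x z) *
      (u : Matrix (Fin 2) (Fin 2) ℂ) = weyl1 x z * (u : Matrix (Fin 2) (Fin 2) ℂ) := by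
    rw [← Matrix.mul_assoc, coe_mul_inv, Matrix.one_mul]
  have e2 : (u : Matrix (Fin 2) (Fin 2) ℂ) * (weyl1 w.1 w.2 * ((u⁻¹ : U2) : Matrix (Fin 2) (Fin 2) ℂ)) *
      (u : Matrix (Fin 2) (Fin 2) ℂ) = (u : Matrix (Fin 2) (Fin 2) ℂ) * weyl1 w.1 w.2 := by
    rw [Matrix.mul_assoc, Matrix.mul_assoc, coe_inv_mul, Matrix.mul_one]
  rw [e1, e2]
  exact h.symm

theorem weyl1_mul_factorMat_pow_four (s : ZMod 2) (p : PauliLabel) :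
    Aligned (weyl1 0 s * p.factorMat * (weyl1 0 s * p.factorMat) *
      (weyl1 0 s * p.factorMat * (weyl1 0 s * p.factorMat))) 1 := by
  -- The constant is 1 for the label `I`. Otherwise it is (1 + iσ)⁴ = -4 when the Pauli in front
  -- commutes with σ, and ((1 - iσ)(1 + iσ))² = 4 when it anticommutes.
  have key : ∃ c ∈ ({1, -4, 4} : Set ℂ), weyl1 0 s * p.factorMat * (weyl1 0 s * p.factorMat) *
      (weyl1 0 s * p.factorMat * (weyl1 0 s * p.factorMat)) = c • 1 := by
    rcases zmod_two_cases s with rfl | rfl <;> cases p <;>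
      simp [PauliLabel.factorMat, weyl1_zero_zero, weyl1_zero_one, Matrix.one_fin_two]
    · exact Or.inr (Or.inl (by linear_combination 4 * Complex.I_mul_I))
    · norm_num
    · exact Or.inr ⟨Or.inl (by
        linear_combination (5 + 4 * Complex.I + Complex.I * Complex.I) * Complex.I_mul_I),
        by linear_combination -8 * Complex.I * Complex.I_mul_I⟩
    · norm_num
    · norm_num
    · exact Or.inr ⟨Or.inl (by
        linear_combination (5 + 4 * Complex.I + Complex.I * Complex.I) * Complex.I_mul_I),
        by linear_combination -8 * Complex.I * Complex.I_mul_I⟩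
  obtain ⟨c, hc, h⟩ := key
  refine ⟨c, ?_, h⟩
  rintro rfl
  norm_num at hc

/-- A Pauli operator times a factor, rescaled so that its fourth power is the identity. -/
theorem exists_normalized_factor (s : ZMod 2) (p : PauliLabel) :
    ∃ u : U2, Aligned (u : Matrix (Fin 2) (Fin 2) ℂ)
        (weyl1 0 s * (p.factor : Matrix (Fin 2) (Fin 2) ℂ)) ∧ u ^ 4 = 1 := by
  obtain ⟨q, hq1, hq2⟩ := PauliLabel.exists_bits 0 s
  have hM : Aligned ((q.op * p.factor : U2) : Matrix (Fin 2) (Fin 2) ℂ)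
      (weyl1 0 s * p.factorMat) := by
    have h := q.mat_aligned.mul p.factor_aligned
    rwa [hq1, hq2] at h
  set M : U2 := q.op * p.factor
  obtain ⟨c, hc, h4⟩ := ((hM.mul hM).mul (hM.mul hM)).trans (weyl1_mul_factorMat_pow_four s p)
  have h4' : ((M ^ 4 : U2) : Matrix (Fin 2) (Fin 2) ℂ) = c • 1 := by
    rw [← h4, SubmonoidClass.coe_pow]
    simp only [pow_succ, pow_zero, one_mul, Matrix.mul_assoc]
  have hc1 : c * star c = 1 := by
    have := coe_mul_inv (M ^ 4)
    have hs : (((M ^ 4)⁻¹ : U2) : Matrix (Fin 2) (Fin 2) ℂ) =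
      star ((M ^ 4 : U2) : Matrix (Fin 2) (Fin 2) ℂ) := rfl
    rw [hs, h4', star_smul, star_one, smul_mul_smul_comm, Matrix.one_mul] at this
    simpa using congrFun (congrFun this 0) 0
  -- The correcting phase is a fourth root of `c⁻¹`. It has modulus one because `c` has, so the
  -- rescaled operator stays unitary.
  obtain ⟨g, hg⟩ := IsAlgClosed.exists_pow_nat_eq c⁻¹ (n := 4) (by norm_num)
  have hcn : ‖c‖ = 1 := by
    have h := congrArg norm hc1
    rw [norm_mul, norm_star, norm_one] at h
    nlinarith [norm_nonneg c]
  have hgn : ‖g‖ = 1 := by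
    have h := congrArg norm hg
    rw [norm_pow, norm_inv, hcn, inv_one] at h
    exact (pow_eq_one_iff_of_nonneg (norm_nonneg g) (by norm_num)).mp h
  have hgg : g * star g = 1 := by
    rw [Complex.star_def, Complex.mul_conj, Complex.normSq_eq_norm_sq, hgn]
    norm_num
  have hg0 : g ≠ 0 := by
    rintro rfl
    simp at hgn
  refine ⟨⟨g • (M : Matrix (Fin 2) (Fin 2) ℂ), ?_⟩, ?_, ?_⟩
  · rw [mem_unitaryGroup_iff, star_smul, smul_mul_smul_comm, hgg, one_smul]
    exact mem_unitaryGroup_iff.mp M.2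
  · exact (aligned_smul hg0 _).trans (hM.trans (p.factor_aligned.symm.mul_left _))
  · apply Subtype.ext
    rw [SubmonoidClass.coe_pow]
    change (g • (M : Matrix (Fin 2) (Fin 2) ℂ)) ^ 4 = 1
    rw [smul_pow, ← SubmonoidClass.coe_pow, h4', smul_smul, hg, inv_mul_cancel₀ hc, one_smul]

/-! ## Weyl operators of `n` qubits -/

section Weyl

variable {n : ℕ}

/-- The Weyl operator `⨂ X ^ (a j) * Z ^ (b j)`. -/
def weyl (a b : Fin n → ZMod 2) : Matrix (Bits n) (Bits n) ℂ :=
  tensorMatrix fun j => weyl1 (a j) (b j)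

theorem weyl_zero_zero : weyl (0 : Fin n → ZMod 2) 0 = 1 := by
  rw [← tensorMatrix_one]
  simp only [weyl, Pi.zero_apply, weyl1_zero_zero]

theorem weyl_mul (a b a' b' : Fin n → ZMod 2) :
    weyl a b * weyl a' b' = sgn (b ⬝ᵥ a') • weyl (a + a') (b + b') := by
  simp only [weyl, tensorMatrix_mul, weyl1_mul, tensorMatrix_smul, prod_sgn]
  rfl

theorem weyl_mul_aligned (a b a' b' : Fin n → ZMod 2) :
    Aligned (weyl a b * weyl a' b') (weyl (a + a') (b + b')) :=
  ⟨_, sgn_ne_zero _, weyl_mul a b a' b'⟩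

theorem weyl_mul_comm (a b a' b' : Fin n → ZMod 2) :
    weyl a b * weyl a' b' = sgn (b ⬝ᵥ a' + b' ⬝ᵥ a) • (weyl a' b' * weyl a b) := by
  rw [weyl_mul, weyl_mul, smul_smul, sgn_add, mul_assoc, sgn_mul_self, mul_one,
    add_comm a, add_comm b]

theorem weyl_aligned_comm (a b a' b' : Fin n → ZMod 2) :
    Aligned (weyl a b * weyl a' b') (weyl a' b' * weyl a b) :=
  ⟨_, sgn_ne_zero _, weyl_mul_comm a b a' b'⟩

theorem weyl_mul_self (a b : Fin n → ZMod 2) : Aligned (weyl a b * weyl a b) 1 := by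
  have h : ∀ v : Fin n → ZMod 2, v + v = 0 := fun v => funext fun _ => CharTwo.add_self_eq_zero _
  simpa only [h, weyl_zero_zero] using weyl_mul_aligned a b a b

theorem weyl_mulVec (a b : Fin n → ZMod 2) (φ : (Fin n → ZMod 2) → ℂ) (x : Fin n → ZMod 2) :
    (weyl a b *ᵥ (φ : Bits n → ℂ)) x = sgn (b ⬝ᵥ (x + a)) * φ (x + a) := by
  have entry : ∀ y : Fin n → ZMod 2,
      weyl a b x y = if y = x + a then sgn (b ⬝ᵥ y) else 0 := by
    intro y
    change ∏ j, (if y j = x j + a j then sgn (b j * y j) else 0) = _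
    split_ifs with h
    · rw [dotProduct, ← prod_sgn]
      refine Finset.prod_congr rfl fun j _ => if_pos ?_
      rw [h]
      rfl
    · obtain ⟨j, hj⟩ := Function.ne_iff.mp h
      exact Finset.prod_eq_zero (Finset.mem_univ j) (if_neg hj)
  change ∑ y : Fin n → ZMod 2, weyl a b x y * φ y = _
  rw [Finset.sum_eq_single (x + a)]
  · rw [entry, if_pos rfl]
  · intro y _ hy
    rw [entry, if_neg hy, zero_mul]
  · exact fun h => absurd (Finset.mem_univ _) h

theorem zmod_two_pi_induction {P : (Fin n → ZMod 2) → Prop} (h0 : P 0)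
    (hs : ∀ x v, P x → P (x + Pi.single v 1)) (x : Fin n → ZMod 2) : P x := by
  have key : ∀ s : Finset (Fin n), P (∑ v ∈ s, Pi.single v 1) := by
    intro s
    induction s using Finset.induction_on with
    | empty => simpa using h0
    | insert v s hv ih => rw [Finset.sum_insert hv, add_comm]; exact hs _ _ ih
  have hx : x = ∑ v with x v = 1, Pi.single v 1 := by
    funext k
    simp only [Finset.sum_apply, Pi.single_apply]
    rw [Finset.sum_ite_eq]
    rcases zmod_two_cases (x k) with h | h <;> simp [h]
  rw [hx]
  exact key _

theorem pauliString_aligned (σ : Fin n → PauliLabel) :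
    Aligned (pauliString σ : Matrix (Bits n) (Bits n) ℂ)
      (weyl (fun j => (σ j).xbit) fun j => (σ j).zbit) :=
  Aligned.tensorMatrix fun j => (σ j).mat_aligned

theorem tensor_mem_pauliGroup {p : Fin n → U2} (hp : ∀ j, p j ∈ pauli1) :
    tensor p ∈ pauliGroup n :=
  Subgroup.subset_closure ⟨p, hp, rfl⟩

theorem pauliString_mem_pauliGroup (σ : Fin n → PauliLabel) : pauliString σ ∈ pauliGroup n :=
  tensor_mem_pauliGroup fun j => (σ j).op_mem_pauli1

theorem exists_pauliString_aligned (a b : Fin n → ZMod 2) :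
    ∃ σ : Fin n → PauliLabel, Aligned (pauliString σ : Matrix (Bits n) (Bits n) ℂ) (weyl a b) := by
  choose σ hx hz using fun j => PauliLabel.exists_bits (a j) (b j)
  refine ⟨σ, ?_⟩
  have h := pauliString_aligned σ
  simpa only [hx, hz] using h

theorem exists_weyl_of_mem_pauliGroup {P : Un n} (hP : P ∈ pauliGroup n) :
    ∃ a b, Aligned (P : Matrix (Bits n) (Bits n) ℂ) (weyl a b) := by
  induction hP using Subgroup.closure_induction with
  | mem P hP =>
    obtain ⟨p, hp, rfl⟩ := hP
    choose a b h using fun j => exists_weyl1_of_mem_pauli1 (hp j)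
    exact ⟨a, b, Aligned.tensorMatrix h⟩
  | one => exact ⟨0, 0, .of_eq weyl_zero_zero.symm⟩
  | mul P Q _ _ hP hQ =>
    obtain ⟨a, b, hP⟩ := hP
    obtain ⟨a', b', hQ⟩ := hQ
    exact ⟨_, _, (hP.mul hQ).trans (weyl_mul_aligned _ _ _ _)⟩
  | inv P _ hP =>
    obtain ⟨a, b, hP⟩ := hP
    exact ⟨a, b, hP.inv (weyl_mul_self a b)⟩

theorem pauliEquiv_iff {U V : Un n} : PauliEquiv U V ↔
    ∃ a b, Aligned (U : Matrix (Bits n) (Bits n) ℂ) (weyl a b * (V : Matrix (Bits n) (Bits n) ℂ)) := by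
  constructor
  · rintro ⟨P, hP, h⟩
    obtain ⟨a, b, hab⟩ := exists_weyl_of_mem_pauliGroup hP
    exact ⟨a, b, (proportional_iff_aligned.mp h).trans (hab.mul_right _)⟩
  · rintro ⟨a, b, h⟩
    obtain ⟨σ, hσ⟩ := exists_pauliString_aligned a b
    exact ⟨_, pauliString_mem_pauliGroup σ,
      proportional_iff_aligned.mpr (h.trans (hσ.symm.mul_right _))⟩

theorem PauliEquiv.symm {U V : Un n} (h : PauliEquiv U V) : PauliEquiv V U := by
  rw [pauliEquiv_iff] at h ⊢
  obtain ⟨a, b, h⟩ := h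
  refine ⟨a, b, ?_⟩
  have h2 := (weyl_mul_self a b).symm.mul_right (V : Matrix (Bits n) (Bits n) ℂ)
  rw [Matrix.one_mul, Matrix.mul_assoc] at h2
  exact h2.trans (h.symm.mul_left _)

theorem PauliEquiv.trans {U V W : Un n} (h : PauliEquiv U V) (h' : PauliEquiv V W) :
    PauliEquiv U W := by
  rw [pauliEquiv_iff] at h h' ⊢
  obtain ⟨a, b, h⟩ := h
  obtain ⟨a', b', h'⟩ := h'
  refine ⟨a + a', b + b', h.trans ((h'.mul_left _).trans ?_)⟩
  rw [← Matrix.mul_assoc]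
  exact (weyl_mul_aligned a b a' b').mul_right _

theorem eq_of_pauliEquiv_expString {σ τ : Fin n → PauliLabel}
    (h : PauliEquiv (expString σ) (expString τ)) : σ = τ := by
  rw [pauliEquiv_iff] at h
  obtain ⟨a, b, h⟩ := h
  funext j
  change Aligned (tensorMatrix _) (tensorMatrix _ * tensorMatrix _) at h
  rw [tensorMatrix_mul] at h
  exact eq_of_factor_aligned (Aligned.of_tensorMatrix (fun j => unitary_ne_zero _) h j)

/-- The weights with which the label string is added to a binary vector by the conjugation with
`expString σ`. -/
def twistWeight (σ : Fin n → PauliLabel) (a b : Fin n → ZMod 2) (j : Fin n) : ZMod 2 :=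
  (σ j).pair (a j) (b j)

/-- The `X`-part of the image of a binary vector under the conjugation with `expString σ`. -/
def twistX (σ : Fin n → PauliLabel) (a b : Fin n → ZMod 2) (j : Fin n) : ZMod 2 :=
  a j + twistWeight σ a b j * (σ j).xbit

/-- The `Z`-part of the image of a binary vector under the conjugation with `expString σ`. -/
def twistZ (σ : Fin n → PauliLabel) (a b : Fin n → ZMod 2) (j : Fin n) : ZMod 2 :=
  b j + twistWeight σ a b j * (σ j).zbit

theorem expString_mul_weyl (σ : Fin n → PauliLabel) (a b : Fin n → ZMod 2) :
    Aligned ((expString σ : Matrix (Bits n) (Bits n) ℂ) * weyl a b)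
      (weyl (twistX σ a b) (twistZ σ a b) * (expString σ : Matrix (Bits n) (Bits n) ℂ)) := by
  change Aligned (tensorMatrix _ * tensorMatrix _) (tensorMatrix _ * tensorMatrix _)
  rw [tensorMatrix_mul, tensorMatrix_mul]
  exact Aligned.tensorMatrix fun j => (σ j).factor_mul_weyl1 (a j) (b j)

theorem twistX_twist (σ : Fin n → PauliLabel) (a b : Fin n → ZMod 2) :
    twistX σ (twistX σ a b) (twistZ σ a b) = a :=
  funext fun j => ((σ j).twist_involutive (a j) (b j)).1

theorem twistZ_twist (σ : Fin n → PauliLabel) (a b : Fin n → ZMod 2) :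
    twistZ σ (twistX σ a b) (twistZ σ a b) = b :=
  funext fun j => ((σ j).twist_involutive (a j) (b j)).2

end Weyl

/-! ## Stabilizers of graph states -/

section Graph

variable {n : ℕ} (G : SimpleGraph (Fin n)) [DecidableRel G.Adj]

/-- The adjacency matrix over `ℤ/2`. -/
abbrev adj2 : Matrix (Fin n) (Fin n) (ZMod 2) := G.adjMatrix (ZMod 2)

theorem canonicalGenerator_eq (v : Fin n) :
    (canonicalGenerator G v : Matrix (Bits n) (Bits n) ℂ) =
      weyl (Pi.single v 1) (adj2 G *ᵥ Pi.single v 1) := by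
  change tensorMatrix _ = tensorMatrix _
  congr 1
  funext k
  rw [Matrix.mulVec_single_one]
  change PauliLabel.mat (if k = v then .X else if G.Adj v k then .Z else .I) =
    weyl1 _ (G.adjMatrix (ZMod 2) k v)
  rw [SimpleGraph.adjMatrix_apply]
  by_cases hk : k = v
  · subst hk
    simp [weyl1_one_zero, PauliLabel.mat]
  · rw [if_neg hk, Pi.single_eq_of_ne hk]
    by_cases h : G.Adj v k
    · rw [if_pos h, if_pos h.symm, weyl1_zero_one]
      rfl
    · rw [if_neg h, if_neg fun h' => h h'.symm, weyl1_zero_zero]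
      rfl

/-- The number of edges modulo `2` in the support of a binary vector. -/
def edgeForm (x : Fin n → ZMod 2) : ZMod 2 :=
  ∑ e : Fin n × Fin n with e.1 < e.2 ∧ G.Adj e.1 e.2, x e.1 * x e.2

theorem graphState_apply (x : Fin n → ZMod 2) :
    graphState G x = sgn (edgeForm G x) * ∏ _j : Fin n, ((1 / Real.sqrt 2 : ℝ) : ℂ) := by
  refine (mulVec_diagonal _ _ _).trans (congrArg₂ (· * ·) ?_ rfl)
  refine (Finset.prod_apply _ _ _).trans ?_
  rw [edgeForm, ← prod_sgn]
  refine Finset.prod_congr rfl fun e _ => ?_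
  change (if x e.1 = 1 ∧ x e.2 = 1 then (-1 : ℂ) else 1) = _
  rcases zmod_two_cases (x e.1) with h | h <;> rcases zmod_two_cases (x e.2) with h' | h' <;>
    simp [h, h']

/-- Only edges at `v` contribute to the change, each by the value of `x` at its other end. The two
correction sums treat `v` as the larger and as the smaller endpoint. -/
theorem edgeForm_add_single (x : Fin n → ZMod 2) (v : Fin n) :
    edgeForm G (x + Pi.single v 1) = edgeForm G x + (adj2 G *ᵥ Pi.single v 1) ⬝ᵥ x := by
  have expand : ∀ e : Fin n × Fin n, (if e.1 < e.2 ∧ G.Adj e.1 e.2 then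
      (x + Pi.single v 1 : Fin n → ZMod 2) e.1 * (x + Pi.single v 1 : Fin n → ZMod 2) e.2 else 0) =
      (if e.1 < e.2 ∧ G.Adj e.1 e.2 then x e.1 * x e.2 else 0) +
      ((if e.2 = v then if e.1 < e.2 ∧ G.Adj e.1 e.2 then x e.1 else 0 else 0) +
        (if e.1 = v then if e.1 < e.2 ∧ G.Adj e.1 e.2 then x e.2 else 0 else 0)) := by
    rintro ⟨i, j⟩
    simp only [Pi.add_apply, Pi.single_apply]
    by_cases h : i < j ∧ G.Adj i j
    · simp only [if_pos h]
      by_cases hi : i = v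
      · have hj : j ≠ v := fun hj => h.1.ne (hi.trans hj.symm)
        simp [hi, hj]
        ring
      · by_cases hj : j = v
        · simp [hi, hj]
          ring
        · simp [hi, hj]
    · simp [if_neg h]
  unfold edgeForm
  rw [Finset.sum_filter, Finset.sum_filter, Finset.sum_congr rfl fun e _ => expand e,
    Finset.sum_add_distrib, Finset.sum_add_distrib]
  congr 1
  rw [Fintype.sum_prod_type, Fintype.sum_prod_type_right]
  simp only [Finset.sum_ite_eq', Finset.mem_univ, if_true]
  rw [← Finset.sum_add_distrib, dotProduct]
  refine Finset.sum_congr rfl fun k _ => ?_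
  rw [mulVec_single_one]
  simp only [col_apply, SimpleGraph.adjMatrix_apply]
  rcases lt_trichotomy k v with h | h | h
  · simp [h, h.not_gt]
  · simp [h]
  · simp [h, h.not_gt, G.adj_comm v k]

theorem graphState_ne_zero (x : Bits n) : graphState G x ≠ 0 := by
  rw [graphState_apply G x]
  refine mul_ne_zero (sgn_ne_zero _) (Finset.prod_ne_zero_iff.mpr fun _ _ => ?_)
  rw [Complex.ofReal_ne_zero]
  positivity

theorem canonicalGenerator_mulVec (v : Fin n) (φ : (Fin n → ZMod 2) → ℂ) (x : Fin n → ZMod 2) :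
    ((canonicalGenerator G v : Matrix (Bits n) (Bits n) ℂ) *ᵥ (φ : Bits n → ℂ)) x =
      sgn ((adj2 G *ᵥ Pi.single v 1) ⬝ᵥ x) * φ (x + Pi.single v 1) := by
  rw [canonicalGenerator_eq, weyl_mulVec, dotProduct_add]
  congr 2
  simp

theorem canonicalGenerator_mulVec_graphState (v : Fin n) :
    (canonicalGenerator G v : Matrix (Bits n) (Bits n) ℂ) *ᵥ graphState G = graphState G := by
  refine funext fun x : Fin n → ZMod 2 => ?_
  refine (canonicalGenerator_mulVec G v (graphState G) x).trans ?_
  refine (congrArg _ (graphState_apply G (x + Pi.single v 1))).trans ?_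
  refine Eq.trans ?_ (graphState_apply G x).symm
  rw [edgeForm_add_single, sgn_add]
  have h2 := sgn_mul_self ((adj2 G *ᵥ Pi.single v 1) ⬝ᵥ x)
  linear_combination (sgn (edgeForm G x) * ∏ _j : Fin n, ((1 / Real.sqrt 2 : ℝ) : ℂ)) * h2

/-- The graph state is determined up to a factor by the canonical generators. -/
theorem eq_smul_graphState {φ : Bits n → ℂ} (h : ∀ v : Fin n,
    (canonicalGenerator G v : Matrix (Bits n) (Bits n) ℂ) *ᵥ φ = φ) :
    ∃ c : ℂ, φ = c • graphState G := by
  refine ⟨φ 0 / graphState G 0, funext fun x => ?_⟩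
  -- Invariance under the generator at `v` links the values at `x` and `x + e_v` by the same sign
  -- for both vectors, so the ratio at 0 propagates to all `x`.
  have key : ∀ x : Fin n → ZMod 2, φ x * graphState G 0 = φ 0 * graphState G x := by
    refine zmod_two_pi_induction rfl fun x v hx => ?_
    have h1 := (canonicalGenerator_mulVec G v φ x).symm.trans (congrFun (h v) x)
    have h2 := (canonicalGenerator_mulVec G v (graphState G) x).symm.trans
      (congrFun (canonicalGenerator_mulVec_graphState G v) x)
    apply mul_left_cancel₀ (sgn_ne_zero ((adj2 G *ᵥ Pi.single v 1) ⬝ᵥ x))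
    refine Eq.trans ?_ (hx.trans ?_)
    · rw [← mul_assoc, h1]
    · rw [mul_left_comm, h2]
  have h0 := graphState_ne_zero G 0
  simp only [Pi.smul_apply, smul_eq_mul]
  field_simp
  exact key x

theorem mulVec_graphState_of_mem_stabilizer {S : Un n} (hS : S ∈ stabilizer G) :
    (S : Matrix (Bits n) (Bits n) ℂ) *ᵥ graphState G = graphState G := by
  induction hS using Subgroup.closure_induction with
  | mem S hS =>
    obtain ⟨v, rfl⟩ := hS
    exact canonicalGenerator_mulVec_graphState G v
  | one => exact one_mulVec _
  | mul S T _ _ hS hT =>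
    change ((S : Matrix (Bits n) (Bits n) ℂ) * (T : Matrix (Bits n) (Bits n) ℂ)) *ᵥ _ = _
    rw [← mulVec_mulVec, hT, hS]
  | inv S _ hS =>
    conv_lhs => rw [← hS]
    rw [mulVec_mulVec, coe_inv_mul, one_mulVec]

theorem exists_stabilizer_aligned (a : Fin n → ZMod 2) :
    ∃ S ∈ stabilizer G, Aligned (S : Matrix (Bits n) (Bits n) ℂ) (weyl a (adj2 G *ᵥ a)) := by
  induction a using zmod_two_pi_induction with
  | h0 => exact ⟨1, one_mem _, .of_eq (by simp [weyl_zero_zero])⟩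
  | hs a v ih =>
    obtain ⟨S, hS, h⟩ := ih
    refine ⟨S * canonicalGenerator G v,
      mul_mem hS (Subgroup.subset_closure (Set.mem_range_self v)), ?_⟩
    rw [mulVec_add]
    refine Aligned.trans ?_ (weyl_mul_aligned _ _ _ _)
    exact h.mul (.of_eq (canonicalGenerator_eq G v))

/-- A Pauli having the graph state as an eigenvector must commute with each canonical generator,
since applying the two in either order gives the same nonzero vector. The commutation sign with the
generator at `v` compares `b v` with the `v`-th entry of θa. -/
theorem weyl_mulVec_graphState_aligned_iff (a b : Fin n → ZMod 2) :
    Aligned (weyl a b *ᵥ graphState G) (graphState G) ↔ b = adj2 G *ᵥ a := by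
  constructor
  · rintro ⟨c, hc, h⟩
    funext v
    have hg : weyl (Pi.single v 1) (adj2 G *ᵥ Pi.single v 1) *ᵥ graphState G = graphState G := by
      rw [← canonicalGenerator_eq]
      exact canonicalGenerator_mulVec_graphState G v
    have h1 : weyl (Pi.single v 1) (adj2 G *ᵥ Pi.single v 1) *ᵥ weyl a b *ᵥ graphState G =
        c • graphState G := by
      rw [h, mulVec_smul, hg]
    have h2 : weyl a b *ᵥ weyl (Pi.single v 1) (adj2 G *ᵥ Pi.single v 1) *ᵥ graphState G =
        c • graphState G := by
      rw [hg, h]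
    rw [mulVec_mulVec, weyl_mul_comm, smul_mulVec, ← mulVec_mulVec, h2] at h1
    have h3 : sgn ((adj2 G *ᵥ Pi.single v 1) ⬝ᵥ a + b ⬝ᵥ Pi.single v 1) = 1 := by
      have h4 := congrFun h1 0
      simp only [Pi.smul_apply, smul_eq_mul] at h4
      exact mul_right_cancel₀ (mul_ne_zero hc (graphState_ne_zero G 0)) (by rw [h4, one_mul])
    rw [sgn_eq_one_iff, CharTwo.add_eq_zero, dotProduct_single_one, Matrix.mulVec_single_one] at h3
    rw [← h3]
    simp only [dotProduct, mulVec, col_apply]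
    refine Finset.sum_congr rfl fun k _ => ?_
    exact congrArg (· * a k) ((G.isSymm_adjMatrix (α := ZMod 2)).apply v k)
  · rintro rfl
    obtain ⟨S, hS, h⟩ := exists_stabilizer_aligned G a
    exact (h.symm.mulVec (.refl _)).trans (.of_eq (mulVec_graphState_of_mem_stabilizer G hS))

end Graph

/-! ## Local Clifford operators of order four -/

section LocalClifford

variable {n : ℕ}

theorem exists_tensor_of_mem_localClifford {U : Un n} (hU : U ∈ localClifford n) :
    ∃ c : Fin n → U2, (∀ j, c j ∈ clifford1) ∧ U = tensor c := by
  induction hU using Subgroup.closure_induction with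
  | mem U hU => exact hU
  | one => exact ⟨1, fun j p hp => by simpa using hp, tensor_one.symm⟩
  | mul U V _ _ hU hV =>
    obtain ⟨c, hc, rfl⟩ := hU
    obtain ⟨d, hd, rfl⟩ := hV
    refine ⟨c * d, fun j p hp => ?_, tensor_mul c d⟩
    have h := hc j _ (hd j p hp)
    simpa only [Pi.mul_apply, _root_.mul_inv_rev, mul_assoc] using h
  | inv U _ hU =>
    obtain ⟨c, hc, rfl⟩ := hU
    exact ⟨c⁻¹, fun j => inv_mem_clifford1 (hc j), tensor_inv c⟩

theorem exists_pauliEquiv_expString {U : Un n} (hU : U ∈ localClifford n) (h4 : U ^ 4 = 1) :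
    ∃ σ : Fin n → PauliLabel, PauliEquiv U (expString σ) := by
  obtain ⟨c, hc, rfl⟩ := exists_tensor_of_mem_localClifford hU
  -- The fourth power of each tensor factor is only known to be a scalar, since phases may cancel
  -- between the qubits.
  have h : ∀ j, Aligned ((c j ^ 4 : U2) : Matrix (Fin 2) (Fin 2) ℂ) 1 := by
    refine Aligned.of_tensorMatrix (fun j => unitary_ne_zero _) ?_
    rw [tensorMatrix_one]
    rw [tensor_pow] at h4
    exact .of_eq (congrArg Subtype.val h4)
  choose σ a b h using fun j => exists_factor_of_clifford1_pow_four (hc j) (h j)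
  refine ⟨σ, pauliEquiv_iff.mpr ⟨a, b, ?_⟩⟩
  change Aligned (tensorMatrix _) (tensorMatrix _ * tensorMatrix _)
  rw [tensorMatrix_mul]
  exact Aligned.tensorMatrix h

/-- A diagonal Pauli operator times `expString σ`, rescaled to a local Clifford operator whose
fourth power is the identity. -/
theorem exists_normalized_expString (s : Fin n → ZMod 2) (σ : Fin n → PauliLabel) :
    ∃ u : Fin n → U2, Aligned (tensor u : Matrix (Bits n) (Bits n) ℂ)
        (weyl 0 s * (expString σ : Matrix (Bits n) (Bits n) ℂ)) ∧
      tensor u ∈ localClifford n ∧ tensor u ^ 4 = 1 := by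
  choose u hu h4 using fun j => exists_normalized_factor (s j) (σ j)
  refine ⟨u, ?_, Subgroup.subset_closure ⟨u, fun j => ?_, rfl⟩, ?_⟩
  · change Aligned (tensorMatrix _) (tensorMatrix _ * tensorMatrix _)
    rw [tensorMatrix_mul]
    exact Aligned.tensorMatrix hu
  · refine mem_clifford1_of_aligned fun x z => ?_
    have h := (σ j).factor_mul_weyl1 x z
    refine ⟨x + (σ j).pair x z * (σ j).xbit, z + (σ j).pair x z * (σ j).zbit,
      ((hu j).mul_right _).trans ?_⟩
    rw [Matrix.mul_assoc]
    refine (h.mul_left _).trans ?_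
    rw [← Matrix.mul_assoc]
    refine ((weyl1_aligned_comm _ _ _ _).mul_right _).trans ?_
    rw [Matrix.mul_assoc]
    exact (hu j).symm.mul_left _
  · rw [tensor_pow, ← tensor_one]
    congr 1
    exact funext h4

theorem pauliString_mul_self (σ : Fin n → PauliLabel) :
    (pauliString σ : Matrix (Bits n) (Bits n) ℂ) * (pauliString σ : Matrix (Bits n) (Bits n) ℂ) =
      1 := by
  change tensorMatrix _ * tensorMatrix _ = 1
  rw [tensorMatrix_mul, ← tensorMatrix_one]
  congr 1
  exact funext fun j => (σ j).mat_mul_self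

end LocalClifford

/-! ## Symmetries of the graph state -/

section Symmetry

variable {n : ℕ} (G : SimpleGraph (Fin n)) [DecidableRel G.Adj]

/-- The conjugation with `expString σ` preserves the binary stabilizer space. -/
def TwistInvariant (σ : Fin n → PauliLabel) : Prop :=
  ∀ a : Fin n → ZMod 2, twistZ σ a (adj2 G *ᵥ a) = adj2 G *ᵥ twistX σ a (adj2 G *ᵥ a)

theorem aligned_mulVec_of_symmetry {U : Un n}
    (h : ∃ c : ℂ, (U : Matrix (Bits n) (Bits n) ℂ) *ᵥ graphState G = c • graphState G) :
    Aligned ((U : Matrix (Bits n) (Bits n) ℂ) *ᵥ graphState G) (graphState G) := by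
  obtain ⟨c, h⟩ := h
  refine ⟨c, ?_, h⟩
  rintro rfl
  rw [zero_smul] at h
  have h2 : graphState G = 0 := by
    rw [← one_mulVec (graphState G), ← coe_inv_mul U, ← mulVec_mulVec, h, mulVec_zero]
  exact graphState_ne_zero G 0 (congrFun h2 0)

/-- Conjugating by a symmetry carries Paulis preserving the graph state up to a scalar to Paulis of
the same kind. The Pauli part of `U` affects only scalars, so the binary vectors move by the twist
alone. -/
theorem twistInvariant_of_symmetry {U : Un n} {σ : Fin n → PauliLabel}
    (hU : PauliEquiv U (expString σ))
    (h : ∃ c : ℂ, (U : Matrix (Bits n) (Bits n) ℂ) *ᵥ graphState G = c • graphState G) :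
    TwistInvariant G σ := by
  obtain ⟨p, q, hU⟩ := pauliEquiv_iff.mp hU
  replace h := aligned_mulVec_of_symmetry G h
  intro a
  rw [← weyl_mulVec_graphState_aligned_iff]
  have h1 : Aligned ((U : Matrix (Bits n) (Bits n) ℂ) * weyl a (adj2 G *ᵥ a))
      (weyl (twistX σ a (adj2 G *ᵥ a)) (twistZ σ a (adj2 G *ᵥ a)) *
        (U : Matrix (Bits n) (Bits n) ℂ)) := by
    refine (hU.mul_right _).trans ?_
    rw [Matrix.mul_assoc]
    refine ((expString_mul_weyl σ _ _).mul_left _).trans ?_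
    rw [← Matrix.mul_assoc]
    refine ((weyl_aligned_comm _ _ _ _).mul_right _).trans ?_
    rw [Matrix.mul_assoc]
    exact hU.symm.mul_left _
  have h2 := h1.mulVec (.refl (graphState G))
  rw [← mulVec_mulVec, ← mulVec_mulVec] at h2
  refine ((Aligned.refl _).mulVec h.symm).trans (h2.symm.trans ?_)
  exact ((Aligned.refl _).mulVec ((weyl_mulVec_graphState_aligned_iff G a _).mpr rfl)).trans h

/-- The invariance condition is quadratic in the labels. Pairing it with `a` produces ∑ w_j², which
over 𝔽₂ equals the linear form ∑ w_j, and its vanishing for every `a` is the claim. -/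
theorem zbit_eq_of_twistInvariant {σ : Fin n → PauliLabel} (h : TwistInvariant G σ) :
    (fun j => (σ j).zbit) = adj2 G *ᵥ fun j => (σ j).xbit := by
  set C : Fin n → ZMod 2 := fun j => (σ j).xbit with hC
  set B : Fin n → ZMod 2 := fun j => (σ j).zbit with hB
  have key : ∀ a, C ⬝ᵥ (adj2 G *ᵥ a) + B ⬝ᵥ a = 0 := by
    intro a
    set w := twistWeight σ a (adj2 G *ᵥ a) with hw
    have hwj : ∀ j, w j = C j * (adj2 G *ᵥ a) j + B j * a j := fun j => rfl
    have h1 : w * B = adj2 G *ᵥ (w * C) := by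
      have h2 : adj2 G *ᵥ a + w * B = adj2 G *ᵥ (a + w * C) := h a
      rw [mulVec_add] at h2
      exact add_left_cancel h2
    have h3 : a ⬝ᵥ (w * B) = (adj2 G *ᵥ a) ⬝ᵥ (w * C) := by
      rw [h1, dotProduct_mulVec, ← mulVec_transpose, (G.isSymm_adjMatrix (α := ZMod 2)).eq]
    -- Expanding one factor `w j` splits the sum into the two sides of `h3`, which cancel in
    -- characteristic two.
    have h4 : ∑ j, w j * w j = 0 := by
      have h5 : ∑ j, w j * w j = (adj2 G *ᵥ a) ⬝ᵥ (w * C) + a ⬝ᵥ (w * B) := by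
        rw [dotProduct, dotProduct, ← Finset.sum_add_distrib]
        refine Finset.sum_congr rfl fun j _ => ?_
        simp only [Pi.mul_apply]
        linear_combination w j * hwj j
      rw [h5, h3]
      exact CharTwo.add_self_eq_zero _
    have hsq : ∀ x : ZMod 2, x * x = x := by decide
    simp only [hsq, hwj, Finset.sum_add_distrib] at h4
    exact h4
  funext v
  have h1 := key (Pi.single v 1)
  rw [CharTwo.add_eq_zero, dotProduct_single_one, dotProduct_mulVec, dotProduct_single_one,
    ← mulVec_transpose, (G.isSymm_adjMatrix (α := ZMod 2)).eq] at h1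
  exact h1.symm

/-- The image of the graph state is a joint eigenvector of the canonical generators, with
eigenvalues ±1 as the generators are involutions. Since Z^s anticommutes with the generator at `v`
exactly when `s v = 1`, a suitable `s` makes every eigenvalue 1. -/
theorem exists_symmetry_of_twistInvariant {σ : Fin n → PauliLabel} (h : TwistInvariant G σ) :
    ∃ (s : Fin n → ZMod 2) (c : ℂ),
      (weyl 0 s * (expString σ : Matrix (Bits n) (Bits n) ℂ)) *ᵥ graphState G =
        c • graphState G := by
  set E := (expString σ : Matrix (Bits n) (Bits n) ℂ) with hE
  set φ := E *ᵥ graphState G with hφ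
  have hφ0 : φ ≠ 0 := by
    intro h0
    have h2 : graphState G = 0 := by
      rw [← one_mulVec (graphState G), ← coe_inv_mul (expString σ), ← mulVec_mulVec, ← hE, ← hφ,
        h0, mulVec_zero]
    exact graphState_ne_zero G 0 (congrFun h2 0)
  have h1 : ∀ a, Aligned (weyl (twistX σ a (adj2 G *ᵥ a)) (twistZ σ a (adj2 G *ᵥ a)) *ᵥ φ) φ := by
    intro a
    have h2 := (expString_mul_weyl σ a (adj2 G *ᵥ a)).mulVec (.refl (graphState G))
    rw [← mulVec_mulVec, ← mulVec_mulVec] at h2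
    exact h2.symm.trans
      ((Aligned.refl E).mulVec ((weyl_mulVec_graphState_aligned_iff G a _).mpr rfl))
  have h2 : ∀ v, ∃ t : ZMod 2,
      (canonicalGenerator G v : Matrix (Bits n) (Bits n) ℂ) *ᵥ φ = sgn t • φ := by
    intro v
    -- The twist is an involution preserving the stabilizer space, so the twisted vector of the
    -- generator at `v` is the one whose image is that generator.
    have h3 := h1 (twistX σ (Pi.single v 1) (adj2 G *ᵥ Pi.single v 1))
    rw [← h, twistX_twist, twistZ_twist, ← canonicalGenerator_eq] at h3
    obtain ⟨m, hm, h3⟩ := h3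
    have h4 : (canonicalGenerator G v : Matrix (Bits n) (Bits n) ℂ) *ᵥ
        (canonicalGenerator G v : Matrix (Bits n) (Bits n) ℂ) *ᵥ φ = φ := by
      rw [mulVec_mulVec]
      exact (congrArg (· *ᵥ φ) (pauliString_mul_self _)).trans (one_mulVec φ)
    rw [h3, mulVec_smul, h3, smul_smul] at h4
    obtain ⟨x, hx⟩ := Function.ne_iff.mp hφ0
    have h5 : m * m = 1 := by
      have h6 := congrFun h4 x
      simp only [Pi.smul_apply, smul_eq_mul] at h6
      exact mul_right_cancel₀ hx (by rw [h6, one_mul])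
    rcases mul_self_eq_one_iff.mp h5 with rfl | rfl
    · exact ⟨0, h3⟩
    · exact ⟨1, by rw [h3, sgn_one]⟩
  choose s hs using h2
  refine ⟨s, ?_⟩
  apply eq_smul_graphState G
  intro v
  rw [← mulVec_mulVec, ← hφ, mulVec_mulVec, canonicalGenerator_eq, weyl_mul_comm,
    ← canonicalGenerator_eq, smul_mulVec, ← mulVec_mulVec, hs, mulVec_smul, smul_smul]
  have h3 : sgn ((adj2 G *ᵥ Pi.single v 1) ⬝ᵥ 0 + s ⬝ᵥ Pi.single v 1) * sgn (s v) = 1 := by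
    rw [dotProduct_zero, zero_add, dotProduct_single_one, sgn_mul_self]
  rw [h3, one_smul]

/-- The binary condition gives a stabilizer element equal to the Pauli string up to a scalar `c`.
Its square is the scalar `c * c` and fixes the graph state, so `c` is a sign. -/
theorem exists_sign_of_zbit_eq {σ : Fin n → PauliLabel}
    (h : (fun j => (σ j).zbit) = adj2 G *ᵥ fun j => (σ j).xbit) :
    ∃ k ∈ ({0, 1} : Set ℕ), ∃ S ∈ stabilizer G,
      (S : Matrix (Bits n) (Bits n) ℂ) =
        (-1 : ℂ) ^ k • (pauliString σ : Matrix (Bits n) (Bits n) ℂ) := by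
  obtain ⟨S, hS, hSW⟩ := exists_stabilizer_aligned G fun j => (σ j).xbit
  rw [← h] at hSW
  obtain ⟨c, hc, hSc⟩ := hSW.trans (pauliString_aligned σ).symm
  have h1 : ((S * S : Un n) : Matrix (Bits n) (Bits n) ℂ) = (c * c) • 1 := by
    change (S : Matrix (Bits n) (Bits n) ℂ) * (S : Matrix (Bits n) (Bits n) ℂ) = _
    rw [hSc, smul_mul_smul_comm, pauliString_mul_self]
  have h2 := mulVec_graphState_of_mem_stabilizer G (mul_mem hS hS)
  rw [h1, smul_mulVec, one_mulVec] at h2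
  have h3 : c * c = 1 := by
    have h4 := congrFun h2 0
    simp only [Pi.smul_apply, smul_eq_mul] at h4
    exact mul_right_cancel₀ (graphState_ne_zero G 0) (by rw [h4, one_mul])
  rcases mul_self_eq_one_iff.mp h3 with rfl | rfl
  · exact ⟨0, by simp, S, hS, by rw [hSc, pow_zero]⟩
  · exact ⟨1, by simp, S, hS, by rw [hSc, pow_one]⟩

/-! ### Label strings and vertex sets. -/

theorem xbit_blockLabel (D : Finset (Fin n)) (j : Fin n) :
    (blockLabel G D j).xbit = if j ∈ D then 1 else 0 := by
  unfold blockLabel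
  split_ifs <;> rfl

theorem zbit_blockLabel (D : Finset (Fin n)) (j : Fin n) :
    (blockLabel G D j).zbit = ∑ k ∈ D, adj2 G j k := by
  unfold blockLabel
  rcases zmod_two_cases (∑ k ∈ D, adj2 G j k) with h | h <;> split_ifs <;> simp_all <;> rfl

theorem eq_blockLabel_of_zbit_eq {σ : Fin n → PauliLabel}
    (h : (fun j => (σ j).zbit) = adj2 G *ᵥ fun j => (σ j).xbit) :
    σ = blockLabel G {j | (σ j).xbit = 1} := by
  funext j
  apply PauliLabel.ext_bits
  · rw [xbit_blockLabel]
    rcases zmod_two_cases (σ j).xbit with h | h <;> simp [h]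
  · rw [zbit_blockLabel, congrFun h j, mulVec, dotProduct, Finset.sum_filter]
    refine Finset.sum_congr rfl fun k _ => ?_
    rcases zmod_two_cases (σ k).xbit with h | h <;> simp [h]

theorem blockLabel_injective : Function.Injective (blockLabel G) := by
  intro D D' h
  ext j
  have h1 := congrArg PauliLabel.xbit (congrFun h j)
  rw [xbit_blockLabel, xbit_blockLabel] at h1
  by_cases hj : j ∈ D <;> by_cases hj' : j ∈ D' <;> simp_all

theorem expString_eq_one : expString (fun _ : Fin n => PauliLabel.I) = 1 :=
  tensor_one

theorem blockLabel_empty : blockLabel G ∅ = fun _ => PauliLabel.I := by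
  funext j
  simp [blockLabel]

theorem exists_blockLabel_of_isNewLC4Symmetry {U : Un n} (hU : IsNewLC4Symmetry G U) :
    ∃ D : Finset (Fin n), D.Nonempty ∧ PauliEquiv U (expString (blockLabel G D)) ∧
      TwistInvariant G (blockLabel G D) := by
  obtain ⟨⟨-, hsym⟩, hC, hnew, h4⟩ := hU
  obtain ⟨σ, hσ⟩ := exists_pauliEquiv_expString hC h4
  have hT := twistInvariant_of_symmetry G hσ hsym
  have hD := eq_blockLabel_of_zbit_eq G (zbit_eq_of_twistInvariant G hT)
  set D : Finset (Fin n) := {j | (σ j).xbit = 1}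
  rw [hD] at hσ hT
  refine ⟨D, Finset.nonempty_iff_ne_empty.mpr fun hD0 => ?_, hσ, hT⟩
  -- For empty `D` the operator would be a Pauli up to a scalar. As it preserves the graph state, it
  -- would be proportional to a stabilizer element.
  rw [hD0, blockLabel_empty, expString_eq_one, pauliEquiv_iff] at hσ
  obtain ⟨a, b, hab⟩ := hσ
  replace hab : Aligned (U : Matrix (Bits n) (Bits n) ℂ) (weyl a b * 1) := hab
  rw [Matrix.mul_one] at hab
  have hL := (weyl_mulVec_graphState_aligned_iff G a b).mp
    ((hab.symm.mulVec (.refl _)).trans (aligned_mulVec_of_symmetry G hsym))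
  obtain ⟨S, hS, hSW⟩ := exists_stabilizer_aligned G a
  rw [← hL] at hSW
  exact hnew S hS (proportional_iff_aligned.mpr (hab.trans hSW.symm))

theorem stabilizer_le_pauliGroup : stabilizer G ≤ pauliGroup n := by
  refine (Subgroup.closure_le _).mpr ?_
  rintro _ ⟨v, rfl⟩
  exact pauliString_mem_pauliGroup _

theorem exists_isNewLC4Symmetry {D : Finset (Fin n)} (hD : D.Nonempty)
    (hT : TwistInvariant G (blockLabel G D)) :
    ∃ U : Un n, IsNewLC4Symmetry G U ∧ PauliEquiv U (expString (blockLabel G D)) := by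
  obtain ⟨s, c, hs⟩ := exists_symmetry_of_twistInvariant G hT
  obtain ⟨u, hu, hC, h4⟩ := exists_normalized_expString s (blockLabel G D)
  have hP : PauliEquiv (tensor u) (expString (blockLabel G D)) := pauliEquiv_iff.mpr ⟨0, s, hu⟩
  refine ⟨tensor u, ⟨⟨⟨u, rfl⟩, ?_⟩, hC, ?_, h4⟩, hP⟩
  · obtain ⟨k, hk, hu⟩ := hu
    exact ⟨k * c, by rw [hu, smul_mulVec, hs, smul_smul]⟩
  -- Proportionality to a stabilizer element would make the operator a Pauli, and uniqueness of the
  -- labels would force `D` to be empty.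
  · intro S hS hprop
    have h1 : PauliEquiv (tensor u) (expString fun _ => PauliLabel.I) := by
      rw [expString_eq_one]
      exact ⟨S, stabilizer_le_pauliGroup G hS, by rwa [mul_one]⟩
    have h2 := eq_of_pauliEquiv_expString (hP.symm.trans h1)
    rw [← blockLabel_empty G] at h2
    exact hD.ne_empty (blockLabel_injective G h2)

end Symmetry

/-! ## The equations over `ℤ/2` -/

section Equations

variable {n : ℕ} (G : SimpleGraph (Fin n)) [DecidableRel G.Adj]

/-- The matrix `θ C + B`, with `C` and `B` the diagonal matrices of the exponents of `X` and `Z`. -/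
def twistMatrix (σ : Fin n → PauliLabel) : Matrix (Fin n) (Fin n) (ZMod 2) :=
  adj2 G * diagonal (fun j => (σ j).xbit) + diagonal fun j => (σ j).zbit

/-- For N = `twistMatrix G σ`, the weights of the twist at (a, θa) are w = Nᵀa, and the twisted
vector misses the stabilizer space by Bw + θCw = Nw. The defect is therefore N Nᵀ a. -/
theorem twistInvariant_iff (σ : Fin n → PauliLabel) :
    TwistInvariant G σ ↔ twistMatrix G σ * (twistMatrix G σ)ᵀ = 0 := by
  have h : ∀ a, (twistMatrix G σ * (twistMatrix G σ)ᵀ) *ᵥ a =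
      twistZ σ a (adj2 G *ᵥ a) + adj2 G *ᵥ twistX σ a (adj2 G *ᵥ a) := by
    intro a
    have hw : (twistMatrix G σ)ᵀ *ᵥ a = twistWeight σ a (adj2 G *ᵥ a) := by
      rw [twistMatrix, transpose_add, transpose_mul, diagonal_transpose, diagonal_transpose,
        (G.isSymm_adjMatrix (α := ZMod 2)).eq, add_mulVec, ← mulVec_mulVec]
      funext j
      simp only [Pi.add_apply, mulVec_diagonal]
      rfl
    have hX : twistX σ a (adj2 G *ᵥ a) =
        a + diagonal (fun j => (σ j).xbit) *ᵥ twistWeight σ a (adj2 G *ᵥ a) := by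
      funext j
      simp only [Pi.add_apply, mulVec_diagonal, twistX]
      ring
    have hZ : twistZ σ a (adj2 G *ᵥ a) =
        adj2 G *ᵥ a + diagonal (fun j => (σ j).zbit) *ᵥ twistWeight σ a (adj2 G *ᵥ a) := by
      funext j
      simp only [Pi.add_apply, mulVec_diagonal, twistZ]
      ring
    rw [← mulVec_mulVec, hw, hX, hZ, twistMatrix, add_mulVec, ← mulVec_mulVec, mulVec_add]
    have h0 : adj2 G *ᵥ a + adj2 G *ᵥ a = 0 := funext fun _ => CharTwo.add_self_eq_zero _
    linear_combination -h0
  constructor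
  · intro hT
    refine ext_of_mulVec_single fun v => ?_
    rw [h, hT, zero_mulVec]
    exact funext fun _ => CharTwo.add_self_eq_zero _
  · intro h0 a
    have h1 := h a
    rw [h0, zero_mulVec] at h1
    exact funext fun j => CharTwo.add_eq_zero.mp (congrFun h1 j).symm

/-- The two blocks of positions together are all vertices. -/
def blockEquiv (π : Equiv.Perm (Fin n)) {d : ℕ} (h : d ≤ n) : Fin d ⊕ Fin (n - d) ≃ Fin n :=
  (finSumFinEquiv.trans (finCongr (Nat.add_sub_of_le h))).trans π

theorem blockEquiv_inl (π : Equiv.Perm (Fin n)) {d : ℕ} (h : d ≤ n) (i : Fin d) :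
    blockEquiv π h (Sum.inl i) = π (fstIdx h i) := rfl

theorem blockEquiv_inr (π : Equiv.Perm (Fin n)) {d : ℕ} (h : d ≤ n) (i : Fin (n - d)) :
    blockEquiv π h (Sum.inr i) = π (sndIdx h i) := rfl

theorem blockEquiv_inl_mem (π : Equiv.Perm (Fin n)) {d : ℕ} (h : d ≤ n) (i : Fin d) :
    blockEquiv π h (Sum.inl i) ∈ firstBlock π h :=
  Finset.mem_image_of_mem _ (Finset.mem_univ i)

theorem blockEquiv_inr_notMem (π : Equiv.Perm (Fin n)) {d : ℕ} (h : d ≤ n) (i : Fin (n - d)) :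
    blockEquiv π h (Sum.inr i) ∉ firstBlock π h := by
  intro hi
  obtain ⟨j, -, hj⟩ := Finset.mem_image.mp hi
  exact Sum.inl_ne_inr ((blockEquiv π h).injective hj)

theorem zbit_blockLabel_firstBlock (π : Equiv.Perm (Fin n)) {d : ℕ} (h : d ≤ n) (v : Fin n) :
    (blockLabel G (firstBlock π h) (π v)).zbit =
      ∑ j : Fin d, orderedAdj G π v (fstIdx h j) := by
  rw [zbit_blockLabel, firstBlock, Finset.sum_image]
  · rfl
  · intro i _ j _ hij
    exact Sum.inl_injective ((blockEquiv π h).injective hij)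

theorem twistMatrix_submatrix (π : Equiv.Perm (Fin n)) {d : ℕ} (h : d ≤ n) :
    (twistMatrix G (blockLabel G (firstBlock π h))).submatrix (blockEquiv π h) (blockEquiv π h) =
      fromBlocks (theta00 G π h + matX G π h) 0 (theta01 G π h)ᵀ (matY G π h) := by
  have hsymm : ∀ i j, adj2 G i j = adj2 G j i :=
    fun i j => (G.isSymm_adjMatrix (α := ZMod 2)).apply j i
  ext i j
  simp only [twistMatrix, submatrix_apply, Matrix.add_apply, mul_diagonal, diagonal_apply,
    (blockEquiv π h).injective.eq_iff, xbit_blockLabel]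
  rcases i with i | i <;> rcases j with j | j
  · rw [if_pos (blockEquiv_inl_mem π h j), mul_one, fromBlocks_apply₁₁, blockEquiv_inl,
      zbit_blockLabel_firstBlock]
    simp only [Sum.inl.injEq, Matrix.add_apply, matX, diagonal_apply]
    rfl
  · rw [if_neg (blockEquiv_inr_notMem π h j)]
    simp
  · rw [if_pos (blockEquiv_inl_mem π h j), mul_one, fromBlocks_apply₂₁, if_neg Sum.inr_ne_inl,
      add_zero, hsymm]
    rfl
  · rw [if_neg (blockEquiv_inr_notMem π h j), mul_zero, zero_add, fromBlocks_apply₂₂,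
      blockEquiv_inr, zbit_blockLabel_firstBlock]
    simp only [Sum.inr.injEq, matY, diagonal_apply]

/-- The X-exponents vanish outside the first block, so the twist matrix is block lower triangular.
The blocks of its product with its transpose are the three equations, the off-diagonal one occurring
twice up to transposition. -/
theorem isSolution_iff (π : Equiv.Perm (Fin n)) {d : ℕ} (h : d ≤ n) :
    IsSolution G π h ↔
      (firstBlock π h).Nonempty ∧ TwistInvariant G (blockLabel G (firstBlock π h)) := by
  have hsymm : (theta00 G π h + matX G π h)ᵀ = theta00 G π h + matX G π h := by
    rw [transpose_add, theta00, orderedAdj, matX, diagonal_transpose, transpose_submatrix,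
      transpose_submatrix, (G.isSymm_adjMatrix (α := ZMod 2)).eq]
  -- A diagonal matrix over 𝔽₂ is idempotent, which is why `matY` enters the third equation
  -- linearly.
  have hYY : matY G π h * (matY G π h)ᵀ = matY G π h := by
    have hsq : ∀ x : ZMod 2, x * x = x := by decide
    rw [matY, diagonal_transpose, diagonal_mul_diagonal]
    simp only [hsq]
  have hne : (firstBlock π h).Nonempty ↔ 1 ≤ d := by
    rw [firstBlock, Finset.image_nonempty, Finset.univ_nonempty_iff, ← Fin.pos_iff_nonempty]
    exact Iff.rfl
  set N := twistMatrix G (blockLabel G (firstBlock π h)) with hN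
  set e := blockEquiv π h
  have hblock : (N * Nᵀ).submatrix e e = fromBlocks ((theta00 G π h + matX G π h) ^ 2)
      ((theta00 G π h + matX G π h) * theta01 G π h)
      ((theta00 G π h + matX G π h) * theta01 G π h)ᵀ
      ((theta01 G π h)ᵀ * theta01 G π h + matY G π h) := by
    rw [← submatrix_mul_equiv N Nᵀ e e e, ← transpose_submatrix, twistMatrix_submatrix,
      fromBlocks_transpose, fromBlocks_multiply, hsymm, hYY, transpose_mul, hsymm,
      transpose_transpose, pow_two]
    simp
  rw [twistInvariant_iff, ← hN, hne, IsSolution]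
  refine and_congr_right fun _ => ?_
  have hzero : N * Nᵀ = 0 ↔ (N * Nᵀ).submatrix e e = 0 := by
    constructor
    · intro h0
      rw [h0, submatrix_zero]
      rfl
    · intro h0
      ext i j
      simpa using congrFun (congrFun h0 (e.symm i)) (e.symm j)
  rw [hzero, hblock, ← fromBlocks_zero, fromBlocks_inj]
  constructor
  · rintro ⟨h1, h2, h3⟩
    exact ⟨h1, h2, by rw [h2, transpose_zero], h3⟩
  · rintro ⟨h1, h2, -, h3⟩
    exact ⟨h1, h2, h3⟩

/-- A bijection from the first |D| positions onto `D` extends to a permutation of all vertices. -/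
theorem exists_firstBlock_eq (D : Finset (Fin n)) :
    ∃ (d : ℕ) (h : d ≤ n) (π : Equiv.Perm (Fin n)), firstBlock π h = D := by
  have hd : D.card ≤ n := by simpa using D.card_le_univ
  have hcard : Fintype.card {x : Fin n // x.val < D.card} = Fintype.card {x : Fin n // x ∈ D} := by
    rw [Fintype.card_coe, Fintype.card_subtype]
    exact Fin.card_filter_val_lt.trans (min_eq_right hd)
  obtain ⟨e⟩ := Fintype.card_eq.mp hcard
  refine ⟨D.card, hd, e.extendSubtype, ?_⟩
  ext v
  simp only [firstBlock, Finset.mem_image, Finset.mem_univ, true_and]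
  constructor
  · rintro ⟨i, rfl⟩
    exact e.extendSubtype_mem _ i.isLt
  · intro hv
    have hx := (e.symm ⟨v, hv⟩).2
    refine ⟨⟨_, hx⟩, ?_⟩
    have h1 := e.extendSubtype_apply_of_mem _ hx
    refine Eq.trans h1 ?_
    simp

end Equations

end GraphStateSym

/-! ### Symmetries and solutions matched through vertex sets. -/

theorem theorem6 (n : ℕ) (G : SimpleGraph (Fin n)) [DecidableRel G.Adj] :
    -- existence of a symmetry is equivalent to solvability of the matrix equations
    ((∃ U : GraphStateSym.Un n, GraphStateSym.IsNewLC4Symmetry G U) ↔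
      ∃ (d : ℕ) (h : d ≤ n) (π : Equiv.Perm (Fin n)), GraphStateSym.IsSolution G π h) ∧
    -- every solution belongs to a symmetry
    (∀ (d : ℕ) (h : d ≤ n) (π : Equiv.Perm (Fin n)), GraphStateSym.IsSolution G π h →
      ∃ U : GraphStateSym.Un n,
        GraphStateSym.IsNewLC4Symmetry G U ∧ GraphStateSym.CorrespondsTo G π h U) ∧
    -- every symmetry belongs to a solution
    (∀ U : GraphStateSym.Un n, GraphStateSym.IsNewLC4Symmetry G U →
      ∃ (d : ℕ) (h : d ≤ n) (π : Equiv.Perm (Fin n)),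
        GraphStateSym.IsSolution G π h ∧ GraphStateSym.CorrespondsTo G π h U) ∧
    -- uniqueness: equal up to local Pauli operators iff the solutions have the same first block
    (∀ (d d' : ℕ) (h : d ≤ n) (h' : d' ≤ n) (π π' : Equiv.Perm (Fin n))
      (U U' : GraphStateSym.Un n),
      GraphStateSym.IsSolution G π h → GraphStateSym.IsSolution G π' h' →
      GraphStateSym.IsNewLC4Symmetry G U → GraphStateSym.IsNewLC4Symmetry G U' →
      GraphStateSym.CorrespondsTo G π h U → GraphStateSym.CorrespondsTo G π' h' U' →
      (GraphStateSym.PauliEquiv U U' ↔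
        GraphStateSym.firstBlock π h = GraphStateSym.firstBlock π' h')) ∧
    -- the Pauli operators in the exponents of a symmetry form a stabilizer element up to sign
    (∀ σ : Fin n → GraphStateSym.PauliLabel,
      (∃ P ∈ GraphStateSym.pauliGroup n,
        P * GraphStateSym.expString σ ∈
          GraphStateSym.localUnitarySymmetries (GraphStateSym.graphState G)) →
      ∃ k ∈ ({0, 1} : Set ℕ), ∃ S ∈ GraphStateSym.stabilizer G,
        (S : Matrix (GraphStateSym.Bits n) (GraphStateSym.Bits n) ℂ) =
          (-1 : ℂ) ^ k •
            (GraphStateSym.pauliString σ :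
              Matrix (GraphStateSym.Bits n) (GraphStateSym.Bits n) ℂ)) := by
  have hto : ∀ (d : ℕ) (h : d ≤ n) (π : Equiv.Perm (Fin n)), GraphStateSym.IsSolution G π h →
      ∃ U : GraphStateSym.Un n,
        GraphStateSym.IsNewLC4Symmetry G U ∧ GraphStateSym.CorrespondsTo G π h U := by
    intro d h π hsol
    obtain ⟨hne, hT⟩ := (GraphStateSym.isSolution_iff G π h).mp hsol
    exact GraphStateSym.exists_isNewLC4Symmetry G hne hT
  have hfrom : ∀ U : GraphStateSym.Un n, GraphStateSym.IsNewLC4Symmetry G U →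
      ∃ (d : ℕ) (h : d ≤ n) (π : Equiv.Perm (Fin n)),
        GraphStateSym.IsSolution G π h ∧ GraphStateSym.CorrespondsTo G π h U := by
    intro U hU
    obtain ⟨D, hne, hP, hT⟩ := GraphStateSym.exists_blockLabel_of_isNewLC4Symmetry G hU
    obtain ⟨d, h, π, rfl⟩ := GraphStateSym.exists_firstBlock_eq D
    exact ⟨d, h, π, (GraphStateSym.isSolution_iff G π h).mpr ⟨hne, hT⟩, hP⟩
  refine ⟨⟨?_, ?_⟩, hto, hfrom, ?_, ?_⟩
  · rintro ⟨U, hU⟩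
    obtain ⟨d, h, π, hsol, -⟩ := hfrom U hU
    exact ⟨d, h, π, hsol⟩
  · rintro ⟨d, h, π, hsol⟩
    obtain ⟨U, hU, -⟩ := hto d h π hsol
    exact ⟨U, hU⟩
  · intro d d' h h' π π' U U' _ _ _ _ hU hU'
    constructor
    · intro hUU
      exact GraphStateSym.blockLabel_injective G (GraphStateSym.eq_of_pauliEquiv_expString
        (hU.symm.trans (hUU.trans hU')))
    · intro hD
      unfold GraphStateSym.CorrespondsTo at hU hU'
      rw [← hD] at hU'
      exact hU.trans hU'.symm
  · rintro σ ⟨P, hP, -, hsym⟩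
    have hPE : GraphStateSym.PauliEquiv (P * GraphStateSym.expString σ)
        (GraphStateSym.expString σ) := ⟨P, hP, 1, (one_smul ℂ _).symm⟩
    exact GraphStateSym.exists_sign_of_zbit_eq G (GraphStateSym.zbit_eq_of_twistInvariant G
      (GraphStateSym.twistInvariant_of_symmetry G hPE hsym))
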